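/- Let the Virasoro algebra at central charge $c=-\tfrac{22}{5}$ be given by generators $L_n$, $n\in\mathbb{Z}$, with the index convention $[L_n,L_m]=(m-n)L_{m+n}+\frac{c}{12}m(m^2-1)\delta_{m+n,0}$, so that $L_n$ with $n>0$ raises the $L_0$-eigenvalue (the conformal weight) by $n$. Let $W$ be its irreducible representation generated by a lowest weight vector $w\neq 0$ with $L_nw=0$ for $n<0$ and $L_0w=-\tfrac15 w$ (the non-vacuum representation of the $(2,5)$ minimal model). A Shapovalov form on $W$ is a Hermitian sesquilinear form $\langle\cdot|\cdot\rangle$ with $L_n^*=L_{-n}$ for all $n$, and we write $\|\psi\|^2=\langle\psi|\psi\rangle$ (the form is indefinite). There is exactly one such form with $\|w\|^2=1$. A vector $\psi\in W$ is called quasi-primary if $L_{-1}\psi=0$; equivalently, $\psi$ is orthogonal to the space $L_1W$ of derivative fields with respect to any Shapovalov form with $\|w\|^2\ne 0$. Then: 1. For every conformal weight $\delta\le 11$ (equivalently, at every level $n\le 11$, where $\delta=-\tfrac15+n$), the space of quasi-primary vectors of weight $\delta$ has dimension at most one. 2. For $\delta<6$ the quasi-primary vectors of weight $\delta$ are zero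 unless $\delta\in\{-\tfrac15,\,-\tfrac15+4,\,-\tfrac15+6\}$; in particular there are none at level $2$. At these three weights the space of quasi-primary vectors is one-dimensional, spanned respectively by $$w,\qquad \psi_4=(52L_4-25L_1L_3)w,\qquad \psi_6=\left(4L_1L_5+3L_3L_3-\tfrac{684}{35}L_6\right)w .$$ 3. For every Shapovalov form on $W$, $$\|\psi_4\|^2=\frac{5928}{5}\,\|w\|^2,\qquad \|\psi_6\|^2=\frac{6539268}{6125}\,\|w\|^2 .$$ -/

import Mathlib

noncomputable section

namespace LeeYang

/-- The defining relations of the Virasoro algebra at central charge `c`, in the index convention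
`[L_n, L_m] = (m - n) L_{m+n} + (c / 12) m (m ^ 2 - 1) δ_{m+n,0}`; the letter `n : ℤ` stands for
`L_n`. Here `L_n` with `n > 0` raises the conformal weight by `n`. -/
inductive VirasoroRel (c : ℂ) : FreeAlgebra ℂ ℤ → FreeAlgebra ℂ ℤ → Prop
  | comm (n m : ℤ) : VirasoroRel c
      (FreeAlgebra.ι ℂ n * FreeAlgebra.ι ℂ m - FreeAlgebra.ι ℂ m * FreeAlgebra.ι ℂ n)
      (((m : ℂ) - (n : ℂ)) • FreeAlgebra.ι ℂ (m + n) +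
        algebraMap ℂ (FreeAlgebra ℂ ℤ)
          (if m + n = 0 then c / 12 * (m : ℂ) * ((m : ℂ) ^ 2 - 1) else 0))

/-- The universal enveloping algebra of the Virasoro algebra with the central element
specialised to the number `c`. Its left modules are the representations of the Virasoro algebra
of central charge `c`. -/
def VirasoroAlg (c : ℂ) : Type := RingQuot (VirasoroRel c)

instance (c : ℂ) : Ring (VirasoroAlg c) := inferInstanceAs (Ring (RingQuot (VirasoroRel c)))

instance (c : ℂ) : Algebra ℂ (VirasoroAlg c) :=
  inferInstanceAs (Algebra ℂ (RingQuot (VirasoroRel c)))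

/-- The quotient map from the free algebra. -/
def virMk (c : ℂ) : FreeAlgebra ℂ ℤ →ₐ[ℂ] VirasoroAlg c :=
  RingQuot.mkAlgHom ℂ (VirasoroRel c)

/-- The generator `L_n` of the enveloping algebra. -/
def virGen (c : ℂ) (n : ℤ) : VirasoroAlg c :=
  virMk c (FreeAlgebra.ι ℂ n)

/-- The left ideal generated by all `L_n` with `n < 0` and by `L_0 - h`. -/
def vermaIdeal (c h : ℂ) : Submodule (VirasoroAlg c) (VirasoroAlg c) :=
  Submodule.span (VirasoroAlg c)
    ({x | ∃ n : ℤ, n < 0 ∧ x = virGen c n} ∪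
      {virGen c 0 - algebraMap ℂ (VirasoroAlg c) h})

/-- The Verma module of central charge `c` and lowest conformal weight `h`. -/
abbrev Verma (c h : ℂ) : Type := VirasoroAlg c ⧸ vermaIdeal c h

/-- The sum of all proper submodules of the Verma module (its largest proper submodule). -/
def maxProper (c h : ℂ) : Submodule (VirasoroAlg c) (Verma c h) :=
  sSup {N | N ≠ ⊤}

/-- The irreducible lowest weight representation of central charge `c` and lowest weight `h`. -/
abbrev Irr (c h : ℂ) : Type := Verma c h ⧸ maxProper c h

/-- The representation `W` of the `(2,5)` minimal model: `c = -22/5`, `h = -1/5`. -/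
abbrev W : Type := Irr (-22 / 5) (-1 / 5)

/-- The lowest weight vector of `W`. -/
def w : W :=
  (maxProper (-22 / 5) (-1 / 5)).mkQ ((vermaIdeal (-22 / 5) (-1 / 5)).mkQ 1)

/-- The operator `L_n` on `W`. -/
def L (n : ℤ) : Module.End ℂ W :=
  Algebra.lsmul ℂ ℂ W (virGen (-22 / 5) n)

/-- `B` is a Shapovalov form on `W`: a Hermitian sesquilinear form (conjugate-linear in the first
argument) for which `L_{-n}` is the adjoint of `L_n`. The squared norm of `ψ` is `B ψ ψ`; the form
is indefinite. -/
structure IsShapovalov (B : W →ₗ⋆[ℂ] W →ₗ[ℂ] ℂ) : Prop where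
  hermitian : ∀ x y, B y x = starRingEnd ℂ (B x y)
  adjoint : ∀ (n : ℤ) (x y), B (L n x) y = B x (L (-n) y)

/-- The derivative fields in `W`: the image of `L_1`. -/
def derivativeFields : Submodule ℂ W := LinearMap.range (L 1)

/-- The quasi-primary fields in `W`: the kernel of `L_{-1}`. -/
def quasiPrimary : Submodule ℂ W := LinearMap.ker (L (-1))

/-- The quasi-primary fields in `W` of conformal weight `δ` (that is, of `L_0`-eigenvalue `δ`). -/
def quasiPrimaryOfWeight (δ : ℝ) : Submodule ℂ W :=
  quasiPrimary ⊓ Module.End.eigenspace (L 0) (δ : ℂ)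

/-- The field `(52 L_4 - 25 L_1 L_3) w`. -/
def psi4 : W := (52 : ℂ) • L 4 w - (25 : ℂ) • L 1 (L 3 w)

/-- The field `(4 L_1 L_5 + 3 L_3 L_3 - (684/35) L_6) w`. -/
def psi6 : W :=
  (4 : ℂ) • L 1 (L 5 w) + (3 : ℂ) • L 3 (L 3 w) - (684 / 35 : ℂ) • L 6 w

end LeeYang

end

open LeeYang

/-! Everything about `W` is controlled by one linear functional, the vacuum expectation value
`vacuum` on the enveloping algebra. It kills `L_n x` for `n > 0`, turns `L_0` on the left into `h`,
kills the left ideal of the Verma module, and takes the value 1 at 1. Its existence says that the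
lowest weight vector of the Verma module is nonzero. Instead of a PBW basis, a free boson with
background charge provides it: on polynomials in infinitely many variables, suitable quadratic
expressions in the modes satisfy the Virasoro relations with `c = 1 - 12 mu ^ 2` and `h = (lam ^ 2 -
mu ^ 2) / 2`, and over `ℂ` every pair `(c, h)` is of this form.

The largest proper submodule is the radical of this functional (`maxProper_vacuum`). Hence the
irreducible quotient has no singular vectors of positive level. Together with the adjoint `L_n ↦
L_{-n}` the functional gives the Shapovalov form, its uniqueness and its nondegeneracy, and so
quasi-primary means orthogonal to derivatives.

Since `L_{-1}` and `L_{-2}` generate all lowering operators, a vector of positive level vanishes as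
soon as both of them kill it. Iterating down to level 0 decides linear relations in `W` by integer
arithmetic (`eval_eq_zero`), with no need to know the null vectors of the Verma module.

By orthogonality, the quasi-primary vectors of level `n` are at most as many as the dimensions of
level `n` modulo the image of `L_1`. A table of relations checked by this procedure shows that for
`n ≤ 11` this quotient is spanned by the class of `L_n w`, or is zero (`lev_le`). The vectors `psi4`
and `psi6` are checked to be quasi-primary in the same way; their nonzero norms show that they span.
-/

noncomputable section

namespace LeeYang

/-! ### The Fock space representation -/

/-- The Fock space of one free boson. -/
abbrev Fock : Type := MvPolynomial ℕ ℂ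

/-- The modes of the free boson with momentum `lam`. -/
def mode (lam : ℂ) : ℤ → Module.End ℂ Fock
  | .ofNat 0 => lam • 1
  | .ofNat (k + 1) => LinearMap.mulLeft ℂ (MvPolynomial.X k)
  | .negSucc k => ((k : ℂ) + 1) • (MvPolynomial.pderiv k).toLinearMap

/-- The coefficient of the Fock vacuum. -/
abbrev vac : Fock →ₗ[ℂ] ℂ := MvPolynomial.lcoeff ℂ 0

variable (lam mu : ℂ)

lemma mode_zero (f : Fock) : mode lam 0 f = lam • f := by
  change mode lam (.ofNat 0) f = _
  simp [mode]

lemma mode_succ (k : ℕ) (f : Fock) : mode lam ((k : ℤ) + 1) f = MvPolynomial.X k * f := by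
  change mode lam (.ofNat (k + 1)) f = _
  simp [mode]

lemma mode_negSucc (k : ℕ) (f : Fock) :
    mode lam (-((k : ℤ) + 1)) f = ((k : ℂ) + 1) • MvPolynomial.pderiv k f := by
  have : (-((k : ℤ) + 1)) = .negSucc k := by omega
  rw [this]
  simp [mode]

lemma int_trichotomy (k : ℤ) : k = 0 ∨ (∃ n : ℕ, k = n + 1) ∨ ∃ n : ℕ, k = -((n : ℤ) + 1) := by
  rcases lt_trichotomy k 0 with h | h | h
  · exact .inr (.inr ⟨(-k - 1).toNat, by omega⟩)
  · exact .inl h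
  · exact .inr (.inl ⟨(k - 1).toNat, by omega⟩)

/-- The Heisenberg relations. The sign follows from positive modes being multiplications and
negative ones derivatives. -/
lemma mode_mode (k l : ℤ) (f : Fock) :
    mode lam k (mode lam l f) =
      mode lam l (mode lam k f) + (if k + l = 0 then (l : ℂ) else 0) • f := by
  classical
  rcases int_trichotomy k with rfl | ⟨i, rfl⟩ | ⟨i, rfl⟩ <;>
  rcases int_trichotomy l with rfl | ⟨j, rfl⟩ | ⟨j, rfl⟩ <;>
  simp only [mode_zero, mode_succ, mode_negSucc, map_smul]
  · simp
  · rw [if_neg (by omega)]; simp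
  · rw [if_neg (by omega)]; module
  · rw [if_neg (by omega)]; simp
  · rw [if_neg (by omega)]; simp [mul_left_comm]
  · by_cases h : i = j
    · subst h
      simp [MvPolynomial.smul_eq_C_mul]; ring
    · rw [if_neg (by omega)]
      simp [MvPolynomial.pderiv_X_of_ne h]
  · rw [if_neg (by omega)]; module
  · by_cases h : i = j
    · subst h
      simp [MvPolynomial.smul_eq_C_mul]
    · rw [if_neg (by omega)]
      simp [MvPolynomial.pderiv_X_of_ne (Ne.symm h)]
  · rw [if_neg (by omega)]
    have : MvPolynomial.pderiv i (MvPolynomial.pderiv j f)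
        = MvPolynomial.pderiv j (MvPolynomial.pderiv i f) := by
      ext m
      simp only [MvPolynomial.coeff_pderiv, add_right_comm]
      by_cases h : i = j
      · rw [h]
      · simp [h, Ne.symm h]; ring
    rw [this]; module

/-- A polynomial involves finitely many variables; this makes the infinite normally ordered sums
finite on each vector. -/
lemma exists_mode_eq_zero (f : Fock) : ∃ N : ℤ, ∀ k < N, mode lam k f = 0 := by
  refine ⟨-(f.vars.sup id : ℕ) - 1, fun k hk ↦ ?_⟩
  obtain ⟨i, rfl⟩ : ∃ i : ℕ, k = -((i : ℤ) + 1) := ⟨(-k - 1).toNat, by omega⟩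
  rw [mode_negSucc, MvPolynomial.pderiv_eq_zero_of_notMem_vars, smul_zero]
  intro hi
  have := Finset.le_sup (f := id) hi
  simp only [id] at this
  omega

lemma mode_one_of_neg {k : ℤ} (hk : k < 0) : mode lam k 1 = 0 := by
  obtain ⟨i, rfl⟩ : ∃ i : ℕ, k = -((i : ℤ) + 1) := ⟨(-k - 1).toNat, by omega⟩
  rw [mode_negSucc, MvPolynomial.pderiv_one, smul_zero]

lemma vac_mode_of_pos {k : ℤ} (hk : 0 < k) (f : Fock) : vac (mode lam k f) = 0 := by
  obtain ⟨i, rfl⟩ : ∃ i : ℕ, k = (i : ℤ) + 1 := ⟨(k - 1).toNat, by omega⟩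
  rw [mode_succ]
  change MvPolynomial.coeff 0 _ = 0
  simp [← MvPolynomial.constantCoeff_eq]

/-! ### Normally ordered square of the boson -/

/-- The summands of the normally ordered square of the boson. -/
def normalOrd (n k : ℤ) : Module.End ℂ Fock :=
  mode lam (max k (n - k)) * mode lam (min k (n - k))

lemma finite_support_normalOrd (n : ℤ) (f : Fock) :
    (Function.support fun k ↦ normalOrd lam n k f).Finite := by
  obtain ⟨N, hN⟩ := exists_mode_eq_zero lam f
  refine (Set.finite_Icc N (n - N)).subset fun k hk ↦ ?_
  have : ¬ min k (n - k) < N := fun h ↦ hk (by simp [normalOrd, hN _ h])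
  simp only [Set.mem_Icc]
  omega

/-- The modes of the normally ordered square of the boson. -/
def quad (n : ℤ) : Module.End ℂ Fock where
  toFun f := ∑ᶠ k : ℤ, normalOrd lam n k f
  map_add' f g := by
    simp only [map_add]
    exact finsum_add_distrib (finite_support_normalOrd lam n f) (finite_support_normalOrd lam n g)
  map_smul' r f := by
    simp only [map_smul, RingHom.id_apply]
    exact (smul_finsum' r (finite_support_normalOrd lam n f)).symm

lemma quad_apply (n : ℤ) (f : Fock) : quad lam n f = ∑ᶠ k : ℤ, normalOrd lam n k f := rfl

lemma map_quad {M : Type*} [AddCommGroup M] [Module ℂ M] (g : Fock →ₗ[ℂ] M) (n : ℤ) (f : Fock) :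
    g (quad lam n f) = ∑ᶠ k : ℤ, g (normalOrd lam n k f) :=
  g.toAddMonoidHom.map_finsum (finite_support_normalOrd lam n f)

/-- Moving `mode lam m` past either factor costs a scalar, which is nonzero only if that factor has
index `-m`, that is, if `k = -m` or `n - k = -m`. -/
lemma normalOrd_mode (n m k : ℤ) (f : Fock) :
    normalOrd lam n k (mode lam m f) = mode lam m (normalOrd lam n k f) +
      ((if k = -m then (m : ℂ) • mode lam (n + m) f else 0) +
        if k = n + m then (m : ℂ) • mode lam (n + m) f else 0) := by
  simp only [normalOrd, Module.End.mul_apply]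
  rw [mode_mode lam (min k (n - k)) m, map_add, map_smul, mode_mode lam _ m]
  have e1 : k + m = 0 ↔ k = -m := by omega
  have e2 : n - k + m = 0 ↔ k = n + m := by omega
  have s1 : k = -m → n - k = n + m := by omega
  rcases le_total k (n - k) with h | h
  · simp only [max_eq_right h, min_eq_left h, e1, e2]
    split_ifs with h1 h2 h2
    · rw [s1 h2, show k = n + m from h1]; module
    · rw [h1]; module
    · rw [s1 h2]; module
    · module
  · simp only [max_eq_left h, min_eq_right h, e1, e2]
    split_ifs with h1 h2 h2
    · rw [s1 h1, show k = n + m from h2]; module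
    · rw [s1 h1]; module
    · rw [h2]; module
    · module

lemma quad_mode (n m : ℤ) (f : Fock) :
    quad lam n (mode lam m f) =
      mode lam m (quad lam n f) + (2 * m : ℂ) • mode lam (n + m) f := by
  have key (a : ℤ) (x : Fock) : ∑ᶠ k : ℤ, (if k = a then x else 0) = x := by
    rw [finsum_eq_single _ a (fun k hk ↦ if_neg hk), if_pos rfl]
  have fin (a : ℤ) (x : Fock) : (Function.support fun k : ℤ ↦ if k = a then x else 0).Finite :=
    (Set.finite_singleton a).subset fun k hk ↦ by
      by_contra h
      exact hk (if_neg h)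
  have fin2 : (Function.support fun k ↦ mode lam m (normalOrd lam n k f)).Finite :=
    (finite_support_normalOrd lam n f).subset fun k hk h ↦ hk (by simp [h])
  rw [map_quad, quad_apply]
  simp only [normalOrd_mode]
  rw [finsum_add_distrib fin2 (((fin _ _).union (fin _ _)).subset (Function.support_add _ _)),
    finsum_add_distrib (fin _ _) (fin _ _), key, key]
  module

/-! ### Virasoro operators on Fock space -/

/-- The Virasoro operators of the free boson with background charge `mu`. -/
def fockVir (n : ℤ) : Module.End ℂ Fock :=
  (1 / 2 : ℂ) • quad lam n + (mu * n) • mode lam n - (if n = 0 then mu ^ 2 / 2 else 0 : ℂ) • 1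

lemma fockVir_apply (n : ℤ) (f : Fock) : fockVir lam mu n f = (1 / 2 : ℂ) • quad lam n f +
    (mu * n) • mode lam n f - (if n = 0 then mu ^ 2 / 2 else 0 : ℂ) • f := rfl

lemma fockVir_mode (n m : ℤ) (f : Fock) :
    fockVir lam mu n (mode lam m f) = mode lam m (fockVir lam mu n f) +
      (m : ℂ) • mode lam (n + m) f - (if n + m = 0 then mu * (n : ℂ) ^ 2 else 0) • f := by
  simp only [fockVir_apply, quad_mode, map_add, map_sub, map_smul, mode_mode lam n m]
  by_cases h : n + m = 0
  · obtain rfl : m = -n := by omega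
    simp only [if_pos h]
    push_cast
    module
  · simp only [if_neg h]
    module

/-! ### Schur's lemma on Fock space and the central term -/

lemma eq_smul_one_of_pderiv_eq_zero {p : Fock} (hp : ∀ i, MvPolynomial.pderiv i p = 0) :
    p = vac p • 1 := by
  rw [MvPolynomial.smul_eq_C_mul, mul_one]
  ext s
  rw [MvPolynomial.coeff_C]
  split_ifs with h
  · subst h; rfl
  · obtain ⟨i, hi⟩ : ∃ i, s i ≠ 0 := by
      by_contra! h'
      exact h (Finsupp.ext h').symm
    have := congrArg (MvPolynomial.coeff (s - Finsupp.single i 1)) (hp i)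
    rw [MvPolynomial.coeff_pderiv, MvPolynomial.coeff_zero,
      tsub_add_cancel_of_le (by simpa [Nat.one_le_iff_ne_zero] using hi)] at this
    rcases mul_eq_zero.1 this with h0 | h0
    · exact h0
    · exact absurd h0 (Nat.cast_add_one_ne_zero _)

/-- The image of 1 is killed by all derivatives, so it is constant; the multiplication operators
carry this scalar from 1 to every polynomial. -/
lemma eq_smul_one_of_commute_mode {T : Module.End ℂ Fock}
    (hT : ∀ k f, T (mode lam k f) = mode lam k (T f)) (f : Fock) : T f = vac (T 1) • f := by
  have h1 : T 1 = vac (T 1) • 1 := by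
    refine eq_smul_one_of_pderiv_eq_zero fun i ↦ ?_
    have := hT (-((i : ℤ) + 1)) 1
    rw [mode_one_of_neg lam (by omega), map_zero, mode_negSucc] at this
    exact (smul_eq_zero.1 this.symm).resolve_left (Nat.cast_add_one_ne_zero i)
  induction f using MvPolynomial.induction_on with
  | C a =>
    have : (MvPolynomial.C a : Fock) = a • 1 := by rw [MvPolynomial.smul_eq_C_mul, mul_one]
    rw [this, map_smul, smul_comm, ← h1]
  | add p q hp hq => rw [map_add, hp, hq, smul_add]
  | mul_X p i hp =>
    have := hT ((i : ℤ) + 1) p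
    rw [mode_succ, mode_succ, hp, mul_comm] at this
    rw [this, mul_smul_comm, mul_comm]

/-- The failure of the Fock space operators to satisfy the Witt relations. -/
def fockAnomaly (n m : ℤ) : Module.End ℂ Fock :=
  fockVir lam mu n * fockVir lam mu m - fockVir lam mu m * fockVir lam mu n -
    ((m : ℂ) - n) • fockVir lam mu (n + m)

lemma fockAnomaly_apply (n m : ℤ) (f : Fock) : fockAnomaly lam mu n m f =
    fockVir lam mu n (fockVir lam mu m f) - fockVir lam mu m (fockVir lam mu n f) -
    ((m : ℂ) - n) • fockVir lam mu (n + m) f := rfl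

/-- The commutator of a Virasoro operator with a mode is a mode plus a scalar, so both commutators
can be evaluated without expanding the quadratic sums. The anomaly is therefore a scalar, read off
from its value on 1. -/
lemma fockAnomaly_mode (n m k : ℤ) (f : Fock) :
    fockAnomaly lam mu n m (mode lam k f) = mode lam k (fockAnomaly lam mu n m f) := by
  simp only [fockAnomaly_apply, fockVir_mode, map_add, map_sub, map_smul]
  have e1 : m + (n + k) = n + m + k := by ring
  have e2 : n + (m + k) = n + m + k := by ring
  simp only [e1, e2]
  by_cases h : n + m + k = 0
  · obtain rfl : k = -n - m := by omega
    simp only [if_pos h]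
    push_cast
    module
  · simp only [if_neg h]
    push_cast
    module

lemma fockAnomaly_eq (n m : ℤ) (f : Fock) :
    fockAnomaly lam mu n m f = vac (fockAnomaly lam mu n m 1) • f :=
  eq_smul_one_of_commute_mode lam (fockAnomaly_mode lam mu n m) f

/-- In each normally ordered product the left factor has the larger index, which is positive, so the
result has no constant term. -/
lemma vac_fockVir_of_pos {n : ℤ} (hn : 0 < n) (f : Fock) : vac (fockVir lam mu n f) = 0 := by
  rw [fockVir_apply, if_neg hn.ne', map_sub, map_add, map_smul, map_smul, map_quad,
    vac_mode_of_pos lam hn, finsum_eq_zero_of_forall_eq_zero]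
  · simp
  · intro k
    exact vac_mode_of_pos lam (by omega) _

lemma vac_fockVir_zero (f : Fock) :
    vac (fockVir lam mu 0 f) = (lam ^ 2 - mu ^ 2) / 2 * vac f := by
  rw [fockVir_apply, if_pos rfl, map_sub, map_add, map_smul, map_smul, map_quad,
    finsum_eq_single _ 0]
  · simp [normalOrd, mode_zero]
    ring
  · intro k hk
    exact vac_mode_of_pos lam (by omega) _

lemma quad_one_eq (n : ℤ) (s : Finset ℤ) (hs : ∀ k, 0 ≤ k → k ≤ n → k ∈ s) :
    quad lam n 1 = ∑ k ∈ s, normalOrd lam n k 1 := by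
  refine finsum_eq_finsetSum_of_support_subset _ fun k hk ↦ ?_
  have : ¬ min k (n - k) < 0 := fun h ↦ hk (by simp [normalOrd, mode_one_of_neg lam h])
  exact hs k (by omega) (by omega)

lemma fockVir_one_of_neg {n : ℤ} (hn : n < 0) : fockVir lam mu n 1 = 0 := by
  rw [fockVir_apply, quad_one_eq lam n ∅ (by intros; omega), if_neg hn.ne, mode_one_of_neg lam hn]
  simp

lemma fockVir_zero_one : fockVir lam mu 0 1 = ((lam ^ 2 - mu ^ 2) / 2) • 1 := by
  rw [fockVir_apply, quad_one_eq lam 0 {0} (by intros; simp; omega)]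
  simp [normalOrd, mode_zero]
  module

lemma fockVir_one_one : fockVir lam mu 1 1 = (lam + mu) • mode lam 1 1 := by
  rw [fockVir_apply, quad_one_eq lam 1 {0, 1} (by intros; simp; omega)]
  simp [normalOrd, mode_zero]
  module

lemma fockVir_two_one : fockVir lam mu 2 1 =
    (lam + 2 * mu) • mode lam 2 1 + (1 / 2 : ℂ) • mode lam 1 (mode lam 1 1) := by
  rw [fockVir_apply, quad_one_eq lam 2 {0, 1, 2} (by intros; simp; omega)]
  simp [normalOrd, mode_zero]
  module

lemma fockAnomaly_zero (m : ℤ) (f : Fock) : fockAnomaly lam mu 0 m f = 0 := by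
  rw [fockAnomaly_eq, fockAnomaly_apply]
  simp only [zero_add, fockVir_zero_one, map_sub, map_smul, vac_fockVir_zero]
  rcases lt_trichotomy m 0 with h | rfl | h
  · simp [fockVir_one_of_neg lam mu h]
  · simp
  · rw [vac_fockVir_of_pos lam mu h]
    simp

lemma vac_one : vac 1 = 1 := by simp [MvPolynomial.lcoeff_apply]

lemma fockVir_comm_eq (n m : ℤ) (f : Fock) :
    fockVir lam mu n (fockVir lam mu m f) = fockVir lam mu m (fockVir lam mu n f) +
      ((m : ℂ) - n) • fockVir lam mu (n + m) f + vac (fockAnomaly lam mu n m 1) • f := by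
  rw [← fockAnomaly_eq, fockAnomaly_apply]
  module

/-- The anomaly shifts the `L_0`-weight by `n + m`, yet as a scalar it preserves it. -/
lemma vac_fockAnomaly_of_ne {n m : ℤ} (h : n + m ≠ 0) : vac (fockAnomaly lam mu n m 1) = 0 := by
  have h0 (k : ℤ) (f : Fock) : fockVir lam mu 0 (fockVir lam mu k f) =
      fockVir lam mu k (fockVir lam mu 0 f) + (k : ℂ) • fockVir lam mu k f := by
    have := fockVir_comm_eq lam mu 0 k f
    rw [fockAnomaly_zero] at this
    simpa using this
  have key : fockVir lam mu 0 (fockAnomaly lam mu n m 1) =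
      fockAnomaly lam mu n m (fockVir lam mu 0 1) +
        ((n : ℂ) + m) • fockAnomaly lam mu n m 1 := by
    simp only [fockAnomaly_apply, map_sub, map_smul, h0, map_add]
    push_cast
    module
  have key' := congrArg vac key
  rw [fockAnomaly_eq lam mu n m (fockVir lam mu 0 1), fockVir_zero_one] at key'
  simp only [map_add, map_smul, vac_fockVir_zero, vac_one, smul_eq_mul] at key'
  have hne : (n : ℂ) + m ≠ 0 := by exact_mod_cast h
  refine (mul_eq_zero.1 (?_ : ((n : ℂ) + m) * _ = 0)).resolve_left hne
  linear_combination -key'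

lemma vac_fockAnomaly_one : vac (fockAnomaly lam mu (-1) 1 1) = 0 := by
  rw [fockAnomaly_apply, fockVir_one_one, fockVir_one_of_neg lam mu (n := -1) (by omega)]
  simp only [map_smul, fockVir_mode, neg_add_cancel, fockVir_zero_one,
    fockVir_one_of_neg lam mu (n := -1) (by omega), mode_zero, map_sub, map_add, vac_one,
    map_zero, if_true, smul_eq_mul]
  push_cast
  ring

lemma vac_fockAnomaly_two :
    vac (fockAnomaly lam mu (-2) 2 1) = (1 - 12 * mu ^ 2) / 2 := by
  rw [fockAnomaly_apply, fockVir_two_one, fockVir_one_of_neg lam mu (n := -2) (by omega)]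
  have e : (-2 : ℤ) + 1 = -1 := rfl
  have h1 : mode lam (-1) (mode lam 1 1) = 1 := by
    rw [mode_mode, mode_one_of_neg lam (by omega)]
    simp
  simp only [map_smul, fockVir_mode, neg_add_cancel, fockVir_zero_one, e, h1,
    fockVir_one_of_neg lam mu (n := -2) (by omega), mode_zero, map_sub, map_add, vac_one,
    map_zero, if_true, smul_eq_mul, mode_one_of_neg lam (k := -1) (by omega),
    show (-1 : ℤ) ≠ 0 by omega, if_false, zero_smul]
  push_cast
  ring

/-- The cocycle identity: apply the operator of index `-(n + 1)` to both sides of `[L_1, L_n] 1 = (n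
- 1) L_{n+1} 1` and compare constant terms. -/
lemma vac_fockAnomaly_step {n : ℕ} (hn : n ≠ 0) :
    ((n : ℂ) - 1) * vac (fockAnomaly lam mu (-(n + 1 : ℤ)) (n + 1) 1) =
      (n + 2) * vac (fockAnomaly lam mu (-n) n 1) := by
  set C := vac (fockAnomaly lam mu (-n) n 1) with hC
  set C' := vac (fockAnomaly lam mu (-(n + 1 : ℤ)) (n + 1) 1) with hC'
  set V := fockVir lam mu with hV
  have hcomm {k l : ℤ} (h : k + l ≠ 0) (f : Fock) :
      V k (V l f) = V l (V k f) + ((l : ℂ) - k) • V (k + l) f := by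
    have := fockVir_comm_eq lam mu k l f
    rwa [vac_fockAnomaly_of_ne lam mu h, zero_smul, add_zero] at this
  have h0 : V 0 1 = _ := fockVir_zero_one lam mu
  have hneg {k : ℤ} (hk : k < 0) : V k 1 = 0 := fockVir_one_of_neg lam mu hk
  have h1 : V 1 (V n 1) = _ := hcomm (by omega) 1
  have h2 (f : Fock) : V (-(n + 1 : ℤ)) (V 1 f) = _ := hcomm (by omega) f
  have h3 : V (-n) (V n 1) = _ := fockVir_comm_eq lam mu (-n) n 1
  have h4 : V (-(n + 1 : ℤ)) (V (n + 1) 1) = _ := fockVir_comm_eq lam mu (-(n + 1)) (n + 1) 1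
  have h5 (f : Fock) : V (-(n + 1 : ℤ)) (V n f) = _ := hcomm (by omega) f
  have h6 : V (-1) (V 1 1) = _ := fockVir_comm_eq lam mu (-1) 1 1
  have e1 : -(n + 1 : ℤ) + 1 = -n := by ring
  have e2 : -(n + 1 : ℤ) + n = -1 := by ring
  rw [vac_fockAnomaly_one, zero_smul, add_zero, ← hV, hneg (k := -1) (by omega), neg_add_cancel, h0] at h6
  rw [← hV, ← hC, hneg (k := -n) (by omega), neg_add_cancel, h0] at h3
  rw [← hV, ← hC', hneg (k := -(n + 1)) (by omega), neg_add_cancel, h0] at h4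
  have key := congrArg (fun f ↦ vac (V (-(n + 1 : ℤ)) f)) h1
  simp only [map_add, map_smul, h2, h4, h5, e1, e2, h3, hneg (k := -(n + 1 : ℤ)) (by omega),
    hneg (k := (-1 : ℤ)) (by omega), hneg (k := (-n : ℤ)) (by omega), map_zero, smul_zero,
    add_zero, zero_add, h6, add_comm (1 : ℤ), vac_one, smul_eq_mul] at key
  push_cast at key
  linear_combination -key

/-- The recursion has the factor `n - 1` on the left, so it says nothing about the step from 1 to 2;
the value at 2 is computed separately and fixes the central charge. -/
lemma vac_fockAnomaly_neg_self (n : ℕ) :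
    vac (fockAnomaly lam mu (-n) n 1) = (1 - 12 * mu ^ 2) / 12 * n * ((n : ℂ) ^ 2 - 1) := by
  rcases Nat.lt_or_ge n 2 with h | h
  · interval_cases n
    · have := fockAnomaly_zero lam mu 0 1
      simp [this]
    · simpa using vac_fockAnomaly_one lam mu
  · induction n, h using Nat.le_induction with
    | base =>
      have := vac_fockAnomaly_two lam mu
      push_cast at this ⊢
      rw [this]
      ring
    | succ n hn ih =>
      have := vac_fockAnomaly_step lam mu (n := n) (by omega)
      rw [ih] at this
      have hne : (n : ℂ) - 1 ≠ 0 := by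
        rw [sub_ne_zero]
        exact_mod_cast (by omega : n ≠ 1)
      refine mul_left_cancel₀ hne ?_
      push_cast
      rw [this]
      ring

lemma vac_fockAnomaly (n m : ℤ) : vac (fockAnomaly lam mu n m 1) =
    if m + n = 0 then (1 - 12 * mu ^ 2) / 12 * m * ((m : ℂ) ^ 2 - 1) else 0 := by
  split_ifs with h
  · obtain rfl : n = -m := by omega
    obtain ⟨k, rfl | rfl⟩ := m.eq_nat_or_neg
    · exact_mod_cast vac_fockAnomaly_neg_self lam mu k
    · have : fockAnomaly lam mu (- -(k : ℤ)) (-k) 1 = - fockAnomaly lam mu (-k) k 1 := by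
        simp only [fockAnomaly_apply, neg_neg, neg_add_cancel, add_neg_cancel]
        push_cast
        module
      rw [this, map_neg, vac_fockAnomaly_neg_self]
      push_cast
      ring
  · exact vac_fockAnomaly_of_ne lam mu (by omega)

/-- The action of the Virasoro algebra of central charge `c` on Fock space. -/
def fockRep (lam mu c : ℂ) (hc : c = 1 - 12 * mu ^ 2) :
    VirasoroAlg c →ₐ[ℂ] Module.End ℂ Fock :=
  RingQuot.liftAlgHom ℂ ⟨FreeAlgebra.lift ℂ (fockVir lam mu), by
    rintro _ _ ⟨n, m⟩
    subst hc
    simp only [map_sub, map_mul, map_add, map_smul, FreeAlgebra.lift_ι_apply, AlgHom.commutes]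
    have := fockVir_comm_eq lam mu n m
    rw [vac_fockAnomaly] at this
    refine LinearMap.ext fun g ↦ ?_
    simp only [LinearMap.sub_apply, Module.End.mul_apply, LinearMap.add_apply,
      LinearMap.smul_apply, Module.algebraMap_end_apply, this, add_comm n m]
    module⟩

lemma fockRep_virGen (lam mu c : ℂ) (hc : c = 1 - 12 * mu ^ 2) (n : ℤ) :
    fockRep lam mu c hc (virGen c n) = fockVir lam mu n := by
  simp only [fockRep, virGen, virMk]
  erw [RingQuot.liftAlgHom_mkAlgHom_apply]
  rw [FreeAlgebra.lift_ι_apply]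

/-! ### Lowest weight vectors -/

section LowestWeight

variable {c h : ℂ}

lemma virMk_surjective (c : ℂ) : Function.Surjective (virMk c) :=
  RingQuot.mkAlgHom_surjective ℂ (VirasoroRel c)

/-- The value of the central cocycle of the Virasoro algebra on `(L_n, L_m)`. -/
def centralTerm (c : ℂ) (n m : ℤ) : ℂ :=
  if m + n = 0 then c / 12 * (m : ℂ) * ((m : ℂ) ^ 2 - 1) else 0

lemma virGen_mul_virGen (c : ℂ) (n m : ℤ) : virGen c n * virGen c m =
    virGen c m * virGen c n + ((m : ℂ) - n) • virGen c (m + n) +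
      algebraMap ℂ _ (centralTerm c n m) := by
  have h : virMk c _ = virMk c _ := RingQuot.mkAlgHom_rel ℂ (VirasoroRel.comm (c := c) n m)
  rw [map_sub, map_mul, map_mul, map_add, map_smul, AlgHom.commutes] at h
  rw [add_assoc, ← sub_eq_iff_eq_add']
  exact h

@[elab_as_elim]
lemma virasoroAlg_induction {P : VirasoroAlg c → Prop}
    (scalar : ∀ a, P (algebraMap ℂ _ a)) (gen : ∀ n, P (virGen c n))
    (mul : ∀ x y, P x → P y → P (x * y)) (add : ∀ x y, P x → P y → P (x + y))
    (x : VirasoroAlg c) : P x := by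
  obtain ⟨x, rfl⟩ := virMk_surjective c x
  induction x using FreeAlgebra.induction with
  | grade0 a => rw [AlgHom.commutes]; exact scalar a
  | grade1 n => exact gen n
  | mul x y hx hy => rw [map_mul]; exact mul _ _ hx hy
  | add x y hx hy => rw [map_add]; exact add _ _ hx hy

variable {V : Type*} [AddCommGroup V] [Module (VirasoroAlg c) V] [Module ℂ V]

/-- `v` is a lowest weight vector of weight `h`. -/
structure IsLowestWeight (c h : ℂ) {V : Type*} [AddCommGroup V] [Module (VirasoroAlg c) V]
    [Module ℂ V] (v : V) : Prop where
  lower : ∀ n < 0, virGen c n • v = 0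
  weight : virGen c 0 • v = h • v

/-- The vector obtained from `v` by the action of a product of generators. -/
def word (c : ℂ) {V : Type*} [AddCommGroup V] [Module (VirasoroAlg c) V] (v : V) (l : List ℕ) : V :=
  l.foldr (fun (a : ℕ) y ↦ virGen c (a : ℤ) • y) v

@[simp]
lemma word_nil (c : ℂ) {V : Type*} [AddCommGroup V] [Module (VirasoroAlg c) V] (v : V) :
    word c v [] = v := rfl

@[simp]
lemma word_cons (c : ℂ) {V : Type*} [AddCommGroup V] [Module (VirasoroAlg c) V] (v : V) (a : ℕ)
    (l : List ℕ) : word c v (a :: l) = virGen c (a : ℤ) • word c v l := rfl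

/-- The span of all products of raising operators of total level `k` applied to `v`. -/
def level (c : ℂ) {V : Type*} [AddCommGroup V] [Module (VirasoroAlg c) V] [Module ℂ V]
    (v : V) (k : ℤ) : Submodule ℂ V :=
  Submodule.span ℂ {y | ∃ l : List ℕ, (∀ a ∈ l, 0 < a) ∧ (l.sum : ℤ) = k ∧ y = word c v l}

lemma word_mem_level (v : V) {l : List ℕ} (hl : ∀ a ∈ l, 0 < a) :
    word c v l ∈ level c v l.sum :=
  Submodule.subset_span ⟨l, hl, rfl, rfl⟩

lemma level_of_neg (v : V) {k : ℤ} (hk : k < 0) : level c v k = ⊥ := by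
  refine Submodule.span_eq_bot.2 ?_
  rintro _ ⟨l, -, rfl, -⟩
  omega

lemma level_zero (v : V) : level c v 0 = Submodule.span ℂ {v} := by
  refine le_antisymm (Submodule.span_le.2 ?_) (Submodule.span_le.2 ?_)
  · rintro _ ⟨l, hl, h0, rfl⟩
    cases l with
    | nil => exact Submodule.mem_span_singleton_self v
    | cons a l =>
      have := hl a (by simp)
      rw [List.sum_cons] at h0
      omega
  · rintro y rfl
    exact word_mem_level (c := c) y (l := []) (by simp)

/-- A positive level is contained in the sum of the images of the raising operators. -/
lemma level_induction {v : V} {k : ℤ} (hk : 0 < k) {S : Submodule ℂ V}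
    (hS : ∀ a : ℕ, 0 < a → ∀ y ∈ level c v (k - a), virGen c (a : ℤ) • y ∈ S) :
    level c v k ≤ S := by
  refine Submodule.span_le.2 ?_
  rintro _ ⟨l, hl, rfl, rfl⟩
  cases l with
  | nil => simp at hk
  | cons a l =>
    refine hS a (hl a (by simp)) (word c v l) ?_
    have := word_mem_level (c := c) v (l := l) fun b hb ↦ hl b (by simp [hb])
    simpa using this

/-- A functional that vanishes on the images of the raising operators is determined on a
lowest weight module by its value on the lowest weight vector. -/
lemma map_eq_zero_of_mem_iSup_level {v : V} {f : V →ₗ[ℂ] ℂ} (h0 : f v = 0)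
    (hf : ∀ n : ℤ, 0 < n → ∀ y, f (virGen c n • y) = 0) {y : V} (hy : y ∈ ⨆ k, level c v k) :
    f y = 0 := by
  have key : ⨆ k, level c v k ≤ LinearMap.ker f := by
    refine iSup_le fun k ↦ ?_
    rcases lt_trichotomy k 0 with hk | rfl | hk
    · rw [level_of_neg v hk]; exact bot_le
    · rw [level_zero]
      exact (Submodule.span_singleton_le_iff_mem _ _).2 h0
    · exact level_induction hk fun a ha y _ ↦ hf a (by omega) y
  exact key hy

variable [IsScalarTower ℂ (VirasoroAlg c) V]

lemma virGen_smul_virGen_smul (n m : ℤ) (y : V) : virGen c n • virGen c m • y =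
    virGen c m • virGen c n • y + ((m : ℂ) - n) • virGen c (m + n) • y +
      centralTerm c n m • y := by
  rw [smul_smul, virGen_mul_virGen, add_smul, add_smul, mul_smul, smul_assoc, algebraMap_smul]

lemma virGen_smul_comm (n : ℤ) (a : ℂ) (y : V) : virGen c n • a • y = a • virGen c n • y :=
  ((Algebra.lsmul ℂ ℂ V (virGen c n)).map_smul a y)

lemma raise_mem_level (v : V) {a : ℤ} (ha : 0 < a) {k : ℤ} {y : V} (hy : y ∈ level c v k) :
    virGen c a • y ∈ level c v (a + k) := by
  lift a to ℕ using ha.le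
  induction hy using Submodule.span_induction with
  | mem y hy =>
    obtain ⟨l, hl, rfl, rfl⟩ := hy
    have := word_mem_level (c := c) v (l := a :: l) (by simpa using ⟨by omega, hl⟩)
    simpa using this
  | zero => simp
  | add x y _ _ hx hy => rw [smul_add]; exact add_mem hx hy
  | smul r x _ hx => rw [virGen_smul_comm]; exact Submodule.smul_mem _ _ hx

/-- Words need not be ordered. The operator is commuted to the right through the word; the induction
is over all `m`, because the commutator changes the index. -/
lemma virGen_mem_level {v : V} (hv : IsLowestWeight c h v) (m : ℤ) {k : ℤ} {y : V}
    (hy : y ∈ level c v k) : virGen c m • y ∈ level c v (m + k) := by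
  induction hy using Submodule.span_induction with
  | mem y hy =>
    obtain ⟨l, hl, rfl, rfl⟩ := hy
    induction l generalizing m with
    | nil =>
      rcases lt_trichotomy m 0 with hm | rfl | hm
      · simp only [word_nil, hv.lower m hm, zero_mem]
      · simp only [word_nil, hv.weight]
        exact Submodule.smul_mem _ _ (word_mem_level (c := c) v (l := []) (by simp))
      · exact raise_mem_level v hm (word_mem_level (c := c) v (l := []) (by simp))
    | cons a l ih =>
      have ha : 0 < a := hl a (by simp)
      have hl' : ∀ b ∈ l, 0 < b := fun b hb ↦ hl b (by simp [hb])
      have e : m + ((a :: l).sum : ℕ) = a + (m + (l.sum : ℤ)) := by simp; ring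
      rw [word_cons, virGen_smul_virGen_smul, e]
      refine add_mem (add_mem ?_ ?_) ?_
      · exact raise_mem_level v (by omega) (ih m hl')
      · rw [show (a : ℤ) + (m + l.sum) = (a + m) + l.sum by ring]
        exact Submodule.smul_mem _ _ (ih _ hl')
      · by_cases h0 : (a : ℤ) + m = 0
        · rw [← add_assoc, h0, zero_add]
          exact Submodule.smul_mem _ _ (word_mem_level v hl')
        · rw [centralTerm, if_neg h0, zero_smul]
          exact zero_mem _
  | zero => simp
  | add x y _ _ hx hy => rw [smul_add]; exact add_mem hx hy
  | smul r x _ hx => rw [virGen_smul_comm]; exact Submodule.smul_mem _ _ hx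

lemma virGen_zero_smul_of_mem_level {v : V} (hv : IsLowestWeight c h v) {k : ℤ} {y : V}
    (hy : y ∈ level c v k) : virGen c 0 • y = (h + k) • y := by
  induction hy using Submodule.span_induction with
  | mem y hy =>
    obtain ⟨l, hl, rfl, rfl⟩ := hy
    induction l with
    | nil => simp [hv.weight]
    | cons a l ih =>
      have hc : centralTerm c 0 a = 0 := by
        rw [centralTerm]
        split_ifs with h0
        · rw [show (a : ℤ) = 0 by omega]; simp
        · rfl
      rw [word_cons, virGen_smul_virGen_smul, ih fun b hb ↦ hl b (by simp [hb]), virGen_smul_comm, hc,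
        add_zero, zero_smul, add_zero, List.sum_cons]
      rw [← add_smul]
      congr 1
      push_cast
      ring
  | zero => simp
  | add x y _ _ hx hy => rw [smul_add, smul_add, hx, hy]
  | smul r x _ hx => rw [virGen_smul_comm, hx]; exact smul_comm _ _ _

lemma smul_mem_iSup_level {v : V} (hv : IsLowestWeight c h v) (u : VirasoroAlg c) {y : V}
    (hy : y ∈ ⨆ k, level c v k) : u • y ∈ ⨆ k, level c v k := by
  induction u using virasoroAlg_induction generalizing y with
  | scalar a => rw [algebraMap_smul (VirasoroAlg c) a y]; exact Submodule.smul_mem _ _ hy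
  | gen n =>
    induction hy using Submodule.iSup_induction' with
    | mem k y hy => exact Submodule.mem_iSup_of_mem (n + k) (virGen_mem_level hv n hy)
    | zero => simp
    | add x y _ _ hx hy => rw [smul_add]; exact add_mem hx hy
  | mul x z hx hz => rw [mul_smul]; exact hx (hz hy)
  | add x z hx hz => rw [add_smul]; exact add_mem (hx hy) (hz hy)

lemma smul_self_mem_iSup_level {v : V} (hv : IsLowestWeight c h v) (u : VirasoroAlg c) :
    u • v ∈ ⨆ k, level c v k :=
  smul_mem_iSup_level hv u <| Submodule.mem_iSup_of_mem 0 <| by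
    rw [level_zero]; exact Submodule.mem_span_singleton_self v

/-- Factor a functional through the orbit map of a cyclic vector. -/
lemma exists_functional {v : V} (hsurj : ∀ y : V, ∃ x : VirasoroAlg c, x • v = y)
    (f : VirasoroAlg c →ₗ[ℂ] ℂ) (hf : ∀ x : VirasoroAlg c, x • v = 0 → f x = 0) :
    ∃ g : V →ₗ[ℂ] ℂ, ∀ x : VirasoroAlg c, g (x • v) = f x := by
  let p : VirasoroAlg c →ₗ[ℂ] V :=
    { toFun := fun x ↦ x • v
      map_add' := fun x y ↦ add_smul x y v
      map_smul' := fun a x ↦ smul_assoc a x v }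
  refine ⟨(p.ker.liftQ f hf).comp (p.quotKerEquivOfSurjective hsurj).symm.toLinearMap, fun x ↦ ?_⟩
  have : (p.quotKerEquivOfSurjective hsurj).symm (x • v) = p.ker.mkQ x := by
    rw [LinearEquiv.symm_apply_eq]
    rfl
  rw [LinearMap.comp_apply, LinearEquiv.coe_coe, this]
  rfl

end LowestWeight

/-! ### The vacuum functional -/

section Vacuum

variable (c h : ℂ)

/-- The functional takes `x` to the constant term of `x` applied to the Fock vacuum; `mu` and `lam`
are square roots that realise the given `c` and `h`. -/
lemma exists_vacuum : ∃ f : VirasoroAlg c →ₗ[ℂ] ℂ, f 1 = 1 ∧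
    (∀ n : ℤ, 0 < n → ∀ x, f (virGen c n * x) = 0) ∧
    (∀ x, f (virGen c 0 * x) = h * f x) ∧ ∀ x ∈ vermaIdeal c h, f x = 0 := by
  obtain ⟨mu, hmu⟩ := IsAlgClosed.exists_pow_nat_eq ((1 - c) / 12) two_pos
  obtain ⟨lam, hlam⟩ := IsAlgClosed.exists_pow_nat_eq (2 * h + mu ^ 2) two_pos
  have hc : c = 1 - 12 * mu ^ 2 := by rw [hmu]; ring
  have hh : h = (lam ^ 2 - mu ^ 2) / 2 := by rw [hlam]; ring
  let ρ := fockRep lam mu c hc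
  have hρ : ∀ n, ρ (virGen c n) = fockVir lam mu n := fockRep_virGen lam mu c hc
  have hI : ∀ x ∈ vermaIdeal c h, ρ x 1 = 0 := by
    intro x hx
    induction hx using Submodule.span_induction with
    | mem x hx =>
      rcases hx with ⟨n, hn, rfl⟩ | rfl
      · rw [hρ, fockVir_one_of_neg lam mu hn]
      · rw [map_sub, hρ, AlgHom.commutes, LinearMap.sub_apply, fockVir_zero_one,
          Module.algebraMap_end_apply, hh, sub_self]
    | zero => simp
    | add x y _ _ hx hy => rw [map_add, LinearMap.add_apply, hx, hy, add_zero]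
    | smul a x _ hx => rw [smul_eq_mul, map_mul, Module.End.mul_apply, hx, map_zero]
  refine ⟨vac ∘ₗ LinearMap.applyₗ 1 ∘ₗ ρ.toLinearMap, ?_, ?_, ?_, ?_⟩
  · simp only [LinearMap.comp_apply, AlgHom.toLinearMap_apply, map_one, LinearMap.applyₗ_apply_apply,
      Module.End.one_apply, vac_one]
  · intro n hn x
    simp only [LinearMap.comp_apply, AlgHom.toLinearMap_apply, map_mul, hρ,
      LinearMap.applyₗ_apply_apply, Module.End.mul_apply, vac_fockVir_of_pos lam mu hn]
  · intro x
    simp only [LinearMap.comp_apply, AlgHom.toLinearMap_apply, map_mul, hρ,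
      LinearMap.applyₗ_apply_apply, Module.End.mul_apply, vac_fockVir_zero, hh]
  · intro x hx
    simp only [LinearMap.comp_apply, AlgHom.toLinearMap_apply, LinearMap.applyₗ_apply_apply,
      hI x hx, map_zero]

/-- The vacuum functional on the enveloping algebra. -/
def vacuum : VirasoroAlg c →ₗ[ℂ] ℂ := (exists_vacuum c h).choose

lemma vacuum_one : vacuum c h 1 = 1 := (exists_vacuum c h).choose_spec.1

lemma vacuum_raise {n : ℤ} (hn : 0 < n) (x) : vacuum c h (virGen c n * x) = 0 :=
  (exists_vacuum c h).choose_spec.2.1 n hn x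

lemma vacuum_zero_mul (x) : vacuum c h (virGen c 0 * x) = h * vacuum c h x :=
  (exists_vacuum c h).choose_spec.2.2.1 x

lemma vacuum_vermaIdeal {x} (hx : x ∈ vermaIdeal c h) : vacuum c h x = 0 :=
  (exists_vacuum c h).choose_spec.2.2.2 x hx

/-- The lowest weight vector of the Verma module. -/
def vermaVec : Verma c h := (vermaIdeal c h).mkQ 1

lemma smul_vermaVec (x : VirasoroAlg c) : x • vermaVec c h = (vermaIdeal c h).mkQ x := by
  rw [vermaVec, ← map_smul, smul_eq_mul, mul_one]

lemma smul_vermaVec_eq_zero {x : VirasoroAlg c} : x • vermaVec c h = 0 ↔ x ∈ vermaIdeal c h := by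
  rw [smul_vermaVec, Submodule.mkQ_apply, Submodule.Quotient.mk_eq_zero]

lemma exists_smul_vermaVec (y : Verma c h) : ∃ x : VirasoroAlg c, x • vermaVec c h = y := by
  obtain ⟨x, rfl⟩ := (vermaIdeal c h).mkQ_surjective y
  exact ⟨x, smul_vermaVec c h x⟩

lemma isLowestWeight_vermaVec : IsLowestWeight c h (vermaVec c h) where
  lower n hn := (smul_vermaVec_eq_zero c h).2 (Submodule.subset_span (.inl ⟨n, hn, rfl⟩))
  weight := by
    have := (smul_vermaVec_eq_zero c h).2 (Submodule.subset_span (.inr rfl))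
    rwa [sub_smul, algebraMap_smul, sub_eq_zero] at this

lemma iSup_level_vermaVec : ⨆ k, level c (vermaVec c h) k = ⊤ := by
  refine eq_top_iff.2 fun y _ ↦ ?_
  obtain ⟨x, rfl⟩ := exists_smul_vermaVec c h y
  exact smul_self_mem_iSup_level (isLowestWeight_vermaVec c h) x

lemma exists_vermaVacuum : ∃ f : Verma c h →ₗ[ℂ] ℂ, ∀ x : VirasoroAlg c,
    f (x • vermaVec c h) = vacuum c h x :=
  exists_functional (exists_smul_vermaVec c h) _ fun _ hx ↦
    vacuum_vermaIdeal c h ((smul_vermaVec_eq_zero c h).1 hx)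

/-- The component of level zero of a vector in the Verma module lies in every submodule that
contains the vector. -/
lemma smul_vermaVec_mem {f : Verma c h →ₗ[ℂ] ℂ}
    (hf : ∀ x : VirasoroAlg c, f (x • vermaVec c h) = vacuum c h x)
    {N : Submodule (VirasoroAlg c) (Verma c h)} {y : Verma c h} (hy : y ∈ N) :
    f y • vermaVec c h ∈ N := by
  -- The product `P K` of the `L_0 - (h + j)` for `1 ≤ j ≤ K` kills the levels 1 to `K` and acts on
  -- level 0 by a nonzero scalar, so after rescaling it projects `y` to level 0 when `K` is large.
  let u (n : ℕ) : VirasoroAlg c := virGen c 0 - algebraMap ℂ _ (h + (n + 1 : ℕ))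
  let P (K : ℕ) : VirasoroAlg c := K.rec 1 fun n p ↦ p * u n
  let s (k : ℤ) (K : ℕ) : ℂ := ∏ n ∈ Finset.range K, ((k : ℂ) - (n + 1 : ℕ))
  have hv := isLowestWeight_vermaVec c h
  have hf1 : f (vermaVec c h) = 1 := by rw [← one_smul (VirasoroAlg c) (vermaVec c h), hf,
    vacuum_one]
  have hP (k : ℤ) (y) (hy : y ∈ level c (vermaVec c h) k) (K : ℕ) : P K • y = s k K • y := by
    induction K with
    | zero => simp [P, s]
    | succ K ih =>
      have e : P (K + 1) = P K * u K := rfl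
      have e' : u K • y = ((k : ℂ) - (K + 1 : ℕ)) • y := by
        rw [sub_smul, algebraMap_smul, virGen_zero_smul_of_mem_level hv hy]
        module
      have hcomm (a : ℂ) : P K • a • y = a • P K • y :=
        (Algebra.lsmul ℂ ℂ (Verma c h) (P K)).map_smul a y
      rw [e, mul_smul, e', hcomm, ih, smul_smul, mul_comm]
      simp only [s, Finset.prod_range_succ]
  have key (y : Verma c h) : ∃ K₀, ∀ K, K₀ ≤ K → P K • y = (s 0 K * f y) • vermaVec c h := by
    have hy : y ∈ ⨆ k, level c (vermaVec c h) k := by rw [iSup_level_vermaVec]; trivial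
    induction hy using Submodule.iSup_induction' with
    | mem k y hy =>
      rcases lt_trichotomy k 0 with hk | rfl | hk
      · rw [level_of_neg _ hk, Submodule.mem_bot] at hy
        exact ⟨0, fun K _ ↦ by simp [hy]⟩
      · refine ⟨0, fun K _ ↦ ?_⟩
        rw [hP 0 y hy]
        rw [level_zero] at hy
        obtain ⟨a, rfl⟩ := Submodule.mem_span_singleton.1 hy
        rw [map_smul, hf1, smul_smul, smul_eq_mul, mul_one]
      · refine ⟨k.toNat, fun K hK ↦ ?_⟩
        have h0 : s k K = 0 := by
          refine Finset.prod_eq_zero (i := k.toNat - 1) (Finset.mem_range.2 (by omega)) ?_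
          rw [show k.toNat - 1 + 1 = k.toNat by omega, sub_eq_zero]
          exact_mod_cast (Int.toNat_of_nonneg hk.le).symm
        have h1 : f y = 0 := by
          obtain ⟨x, rfl⟩ := exists_smul_vermaVec c h y
          have := congrArg f (virGen_zero_smul_of_mem_level hv hy)
          rw [smul_smul, hf, vacuum_zero_mul, map_smul, hf, smul_eq_mul, add_mul,
            left_eq_add] at this
          rw [hf]
          exact (mul_eq_zero.1 this).resolve_left (by exact_mod_cast hk.ne')
        rw [hP k y hy, h0, h1, mul_zero, zero_smul, zero_smul]
    | zero => exact ⟨0, fun K _ ↦ by simp⟩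
    | add x y _ _ hx hy =>
      obtain ⟨K₁, h₁⟩ := hx
      obtain ⟨K₂, h₂⟩ := hy
      refine ⟨max K₁ K₂, fun K hK ↦ ?_⟩
      rw [smul_add, h₁ K (le_of_max_le_left hK), h₂ K (le_of_max_le_right hK), map_add]
      module
  obtain ⟨K, hK⟩ := key y
  have hs : s 0 K ≠ 0 := Finset.prod_ne_zero_iff.2 fun n _ ↦ by
    rw [Int.cast_zero, zero_sub, neg_ne_zero]
    exact Nat.cast_ne_zero.2 n.succ_ne_zero
  have : (algebraMap ℂ (VirasoroAlg c) (s 0 K)⁻¹ * P K) • y = f y • vermaVec c h := by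
    rw [mul_smul, hK K le_rfl, algebraMap_smul, smul_smul, inv_mul_cancel_left₀ hs]
  rw [← this]
  exact N.smul_mem _ hy

/-- A submodule on which `f` is not identically zero contains the generator and is everything;
conversely the vectors on the right form a submodule, proper since `f` is 1 at the generator. -/
lemma maxProper_vacuum {f : Verma c h →ₗ[ℂ] ℂ}
    (hf : ∀ x : VirasoroAlg c, f (x • vermaVec c h) = vacuum c h x) (y : Verma c h) :
    y ∈ maxProper c h ↔ ∀ x : VirasoroAlg c, f (x • y) = 0 := by
  let R : Submodule (VirasoroAlg c) (Verma c h) :=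
    { carrier := {y | ∀ x : VirasoroAlg c, f (x • y) = 0}
      zero_mem' := fun x ↦ by simp
      add_mem' := fun ha hb x ↦ by rw [smul_add, map_add, ha x, hb x, add_zero]
      smul_mem' := fun a y hy x ↦ by rw [smul_smul]; exact hy _ }
  have hR : maxProper c h = R := by
    refine le_antisymm (sSup_le fun N hN y hy x ↦ ?_) (le_sSup fun hR ↦ ?_)
    · by_contra hne
      refine hN (eq_top_iff.2 fun z _ ↦ ?_)
      have h1 := smul_vermaVec_mem c h hf (N.smul_mem x hy)
      have h2 := N.smul_mem (algebraMap ℂ _ (f (x • y))⁻¹) h1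
      rw [algebraMap_smul, inv_smul_smul₀ hne] at h2
      obtain ⟨u, rfl⟩ := exists_smul_vermaVec c h z
      exact N.smul_mem u h2
    · have : vermaVec c h ∈ R := hR ▸ trivial
      have := this 1
      rw [hf, vacuum_one] at this
      exact one_ne_zero this
  rw [hR]
  rfl

/-! ### The irreducible lowest weight module -/

/-- The lowest weight vector of the irreducible module. -/
def irrVec : Irr c h := (maxProper c h).mkQ (vermaVec c h)

lemma smul_irrVec (x : VirasoroAlg c) :
    x • irrVec c h = (maxProper c h).mkQ (x • vermaVec c h) := by
  rw [irrVec, map_smul]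

lemma exists_smul_irrVec (y : Irr c h) : ∃ x : VirasoroAlg c, x • irrVec c h = y := by
  obtain ⟨y, rfl⟩ := (maxProper c h).mkQ_surjective y
  obtain ⟨x, rfl⟩ := exists_smul_vermaVec c h y
  exact ⟨x, smul_irrVec c h x⟩

lemma isLowestWeight_irrVec : IsLowestWeight c h (irrVec c h) where
  lower n hn := by rw [smul_irrVec, (isLowestWeight_vermaVec c h).lower n hn, map_zero]
  weight := by
    rw [smul_irrVec, (isLowestWeight_vermaVec c h).weight]
    rfl

lemma iSup_level_irrVec : ⨆ k, level c (irrVec c h) k = ⊤ := by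
  refine eq_top_iff.2 fun y _ ↦ ?_
  obtain ⟨x, rfl⟩ := exists_smul_irrVec c h y
  exact smul_self_mem_iSup_level (isLowestWeight_irrVec c h) x

lemma smul_irrVec_eq_zero (x : VirasoroAlg c) :
    x • irrVec c h = 0 ↔ ∀ u, vacuum c h (u * x) = 0 := by
  obtain ⟨f, hf⟩ := exists_vermaVacuum c h
  rw [smul_irrVec, Submodule.mkQ_apply, Submodule.Quotient.mk_eq_zero, maxProper_vacuum c h hf]
  simp only [smul_smul, hf]

lemma exists_irrVacuum : ∃ f : Irr c h →ₗ[ℂ] ℂ, ∀ x : VirasoroAlg c,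
    f (x • irrVec c h) = vacuum c h x :=
  exists_functional (exists_smul_irrVec c h) _ fun x hx ↦ by
    simpa using (smul_irrVec_eq_zero c h x).1 hx 1

/-- The vacuum functional on the irreducible module. -/
def irrVacuum : Irr c h →ₗ[ℂ] ℂ := (exists_irrVacuum c h).choose

lemma irrVacuum_smul (x : VirasoroAlg c) : irrVacuum c h (x • irrVec c h) = vacuum c h x :=
  (exists_irrVacuum c h).choose_spec x

lemma irrVacuum_irrVec : irrVacuum c h (irrVec c h) = 1 := by
  rw [← one_smul (VirasoroAlg c) (irrVec c h), irrVacuum_smul, vacuum_one]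

lemma irrVacuum_raise {n : ℤ} (hn : 0 < n) (y : Irr c h) : irrVacuum c h (virGen c n • y) = 0 := by
  obtain ⟨x, rfl⟩ := exists_smul_irrVec c h y
  rw [smul_smul, irrVacuum_smul, vacuum_raise c h hn]

lemma irrVacuum_zero (y : Irr c h) :
    irrVacuum c h (virGen c 0 • y) = h * irrVacuum c h y := by
  obtain ⟨x, rfl⟩ := exists_smul_irrVec c h y
  rw [smul_smul, irrVacuum_smul, irrVacuum_smul, vacuum_zero_mul]

lemma eq_zero_of_irrVacuum_smul {y : Irr c h}
    (hy : ∀ u : VirasoroAlg c, irrVacuum c h (u • y) = 0) : y = 0 := by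
  obtain ⟨x, rfl⟩ := exists_smul_irrVec c h y
  refine (smul_irrVec_eq_zero c h x).2 fun u ↦ ?_
  rw [← irrVacuum_smul, mul_smul, hy]

/-- The irreducible module has no singular vectors of positive level. -/
lemma eq_zero_of_isLowestWeight {y : Irr c h} {k : ℂ} (hk : k ≠ h) (hy : IsLowestWeight c k y) :
    y = 0 := by
  refine eq_zero_of_irrVacuum_smul c h fun u ↦ ?_
  refine map_eq_zero_of_mem_iSup_level ?_ (fun n hn y ↦ irrVacuum_raise c h hn y)
    (smul_self_mem_iSup_level hy u)
  have := congrArg (irrVacuum c h) hy.weight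
  rw [irrVacuum_zero, map_smul, smul_eq_mul, ← sub_eq_zero, ← sub_mul] at this
  exact (mul_eq_zero.1 this).resolve_left (sub_ne_zero.2 hk.symm)

/-- `[L_{-1}, L_{-k-1}] = -k L_{-k-2}` with `k ≥ 1` produces all further lowering operators. -/
lemma lower_eq_zero {V : Type*} [AddCommGroup V] [Module (VirasoroAlg c) V] [Module ℂ V]
    [IsScalarTower ℂ (VirasoroAlg c) V] {y : V} (h1 : virGen c (-1) • y = 0)
    (h2 : virGen c (-2) • y = 0) {n : ℤ} (hn : n < 0) : virGen c n • y = 0 := by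
  obtain ⟨k, rfl⟩ : ∃ k : ℕ, n = -((k : ℤ) + 1) := ⟨(-n - 1).toNat, by omega⟩
  rcases Nat.eq_zero_or_pos k with rfl | hk
  · simpa using h1
  induction k, hk using Nat.le_induction with
  | base => simpa using h2
  | succ k hk ih =>
    have := virGen_smul_virGen_smul (c := c) (-1) (-((k : ℤ) + 1)) y
    rw [ih (by omega), h1, smul_zero, smul_zero, centralTerm, if_neg (by omega), zero_smul,
      add_zero, zero_add] at this
    have hne : ((-((k : ℤ) + 1) : ℤ) : ℂ) - (-1 : ℤ) ≠ 0 := by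
      rw [← Int.cast_sub, Int.cast_ne_zero]
      omega
    rw [show -(((k + 1 : ℕ) : ℤ) + 1) = -((k : ℤ) + 1) + -1 by push_cast; ring]
    exact (smul_eq_zero.1 this.symm).resolve_left hne

lemma eq_zero_of_lower {k : ℤ} (hk : k ≠ 0) {y : Irr c h} (hy : y ∈ level c (irrVec c h) k)
    (h1 : virGen c (-1) • y = 0) (h2 : virGen c (-2) • y = 0) : y = 0 :=
  eq_zero_of_isLowestWeight c h (k := h + k) (by simpa using hk)
    ⟨fun _ hn ↦ lower_eq_zero c h1 h2 hn,
      virGen_zero_smul_of_mem_level (isLowestWeight_irrVec c h) hy⟩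

end Vacuum

/-! ### The Shapovalov form -/

section Star

open MulOpposite

variable {c : ℂ}

/-- Complex conjugation of the coefficients in the free algebra. -/
def freeConj : FreeAlgebra ℂ ℤ →+* FreeAlgebra ℂ ℤ :=
  (FreeAlgebra.equivMonoidAlgebraFreeMonoid.symm.toRingEquiv.toRingHom.comp
    (MonoidAlgebra.mapRingHom (FreeMonoid ℤ) (starRingEnd ℂ))).comp
      FreeAlgebra.equivMonoidAlgebraFreeMonoid.toRingEquiv.toRingHom

lemma freeConj_ι (n : ℤ) : freeConj (FreeAlgebra.ι ℂ n) = FreeAlgebra.ι ℂ n := by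
  simp [freeConj, FreeAlgebra.equivMonoidAlgebraFreeMonoid]

lemma freeConj_algebraMap (a : ℂ) :
    freeConj (algebraMap ℂ _ a) = algebraMap ℂ _ (starRingEnd ℂ a) := by
  simp [freeConj, FreeAlgebra.equivMonoidAlgebraFreeMonoid, Algebra.smul_def]

lemma conj_centralTerm (hc : starRingEnd ℂ c = c) (n m : ℤ) :
    starRingEnd ℂ (centralTerm c n m) = centralTerm c (-m) (-n) := by
  rw [centralTerm, centralTerm]
  by_cases h : m + n = 0
  · obtain rfl : m = -n := by omega
    rw [if_pos (by omega), if_pos (by omega)]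
    simp [hc, Complex.conj_ofNat]
  · rw [if_neg h, if_neg (by omega), map_zero]

/-- The conjugate-linear anti-homomorphism on the free algebra with `L_n ↦ L_{-n}`. -/
def freeStar (c : ℂ) : FreeAlgebra ℂ ℤ →+* (VirasoroAlg c)ᵐᵒᵖ :=
  (FreeAlgebra.lift ℂ fun n : ℤ ↦ op (virGen c (-n))).toRingHom.comp freeConj

lemma freeStar_ι (n : ℤ) : freeStar c (FreeAlgebra.ι ℂ n) = op (virGen c (-n)) := by
  simp [freeStar, freeConj_ι]

lemma freeStar_algebraMap (a : ℂ) :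
    freeStar c (algebraMap ℂ _ a) = op (algebraMap ℂ _ (starRingEnd ℂ a)) := by
  simp [freeStar, freeConj_algebraMap]

/-- Reversing products turns the relation for `(n, m)` into the one for `(-m, -n)`. -/
lemma freeStar_rel (hc : starRingEnd ℂ c = c) {x y : FreeAlgebra ℂ ℤ} (hxy : VirasoroRel c x y) :
    freeStar c x = freeStar c y := by
  obtain ⟨n, m⟩ := hxy
  have h := virGen_mul_virGen c (-m) (-n)
  rw [← conj_centralTerm hc, centralTerm, add_assoc, ← sub_eq_iff_eq_add'] at h
  rw [Algebra.smul_def] at h ⊢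
  simp only [map_sub, map_add, map_mul, freeStar_ι, freeStar_algebraMap, ← op_mul, ← op_sub,
    map_intCast]
  have e : op (algebraMap ℂ (VirasoroAlg c) ((-n : ℤ) - (-m : ℤ))) = ((m - n : ℤ) : _) := by
    rw [← Int.cast_sub, map_intCast, op_intCast]
    congr 1
    ring
  rw [h, neg_add_rev, op_add, op_mul, e, ← Int.cast_sub, (Int.cast_commute _ _).eq]

/-- The conjugate-linear anti-automorphism of the Virasoro algebra with `L_n ↦ L_{-n}`. -/
def virStar (hc : starRingEnd ℂ c = c) : VirasoroAlg c →+* (VirasoroAlg c)ᵐᵒᵖ :=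
  RingQuot.lift ⟨freeStar c, fun _ _ ↦ freeStar_rel hc⟩

lemma virStar_virMk (hc : starRingEnd ℂ c = c) (x : FreeAlgebra ℂ ℤ) :
    virStar hc (virMk c x) = freeStar c x := by
  have e : virMk c x = RingQuot.mkRingHom (VirasoroRel c) x :=
    DFunLike.congr_fun (RingQuot.mkAlgHom_coe ℂ (VirasoroRel c)) x
  exact (congrArg (virStar hc) e).trans
    (RingQuot.lift_mkRingHom_apply (freeStar c) (fun _ _ ↦ freeStar_rel hc) x)

lemma virStar_virGen (hc : starRingEnd ℂ c = c) (n : ℤ) :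
    virStar hc (virGen c n) = op (virGen c (-n)) := by
  rw [virGen, virStar_virMk, freeStar_ι]

lemma virStar_algebraMap (hc : starRingEnd ℂ c = c) (a : ℂ) :
    virStar hc (algebraMap ℂ _ a) = op (algebraMap ℂ _ (starRingEnd ℂ a)) := by
  rw [← (virMk c).commutes, virStar_virMk, freeStar_algebraMap]

/-- The adjoint of an element of the Virasoro algebra. -/
def adj (hc : starRingEnd ℂ c = c) (x : VirasoroAlg c) : VirasoroAlg c := unop (virStar hc x)

variable (hc : starRingEnd ℂ c = c)

lemma adj_virGen (n : ℤ) : adj hc (virGen c n) = virGen c (-n) := by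
  rw [adj, virStar_virGen, unop_op]

lemma adj_algebraMap (a : ℂ) :
    adj hc (algebraMap ℂ _ a) = algebraMap ℂ _ (starRingEnd ℂ a) := by
  rw [adj, virStar_algebraMap, unop_op]

lemma adj_add (x y : VirasoroAlg c) : adj hc (x + y) = adj hc x + adj hc y := by
  simp [adj]

lemma adj_sub (x y : VirasoroAlg c) : adj hc (x - y) = adj hc x - adj hc y := by
  simp [adj]

lemma adj_mul (x y : VirasoroAlg c) : adj hc (x * y) = adj hc y * adj hc x := by
  simp [adj]

lemma adj_one : adj hc 1 = 1 := by simp [adj]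

lemma adj_smul (a : ℂ) (x : VirasoroAlg c) : adj hc (a • x) = starRingEnd ℂ a • adj hc x := by
  rw [Algebra.smul_def, adj_mul, adj_algebraMap, ← Algebra.commutes, ← Algebra.smul_def]

lemma adj_adj (x : VirasoroAlg c) : adj hc (adj hc x) = x := by
  induction x using virasoroAlg_induction with
  | scalar a => simp [adj_algebraMap]
  | gen n => simp [adj_virGen]
  | mul x y hx hy => rw [adj_mul, adj_mul, hx, hy]
  | add x y hx hy => rw [adj_add, adj_add, hx, hy]

variable {h : ℂ}

/-- The complex conjugate of the vacuum functional on adjoints. -/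
def conjVacuum (h : ℂ) : VirasoroAlg c →ₗ[ℂ] ℂ where
  toFun x := starRingEnd ℂ (vacuum c h (adj hc x))
  map_add' x y := by rw [adj_add, map_add, map_add]
  map_smul' a x := by
    rw [adj_smul, map_smul, smul_eq_mul, map_mul, Complex.conj_conj, smul_eq_mul, RingHom.id_apply]

lemma conjVacuum_apply (x : VirasoroAlg c) :
    conjVacuum hc h x = starRingEnd ℂ (vacuum c h (adj hc x)) := rfl

lemma conjVacuum_vermaIdeal (hh : starRingEnd ℂ h = h) {x : VirasoroAlg c}
    (hx : x ∈ vermaIdeal c h) : conjVacuum hc h x = 0 := by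
  suffices ∀ a, conjVacuum hc h (a * x) = 0 by simpa using this 1
  induction hx using Submodule.span_induction with
  | mem x hx =>
    intro a
    rw [conjVacuum_apply, adj_mul]
    rcases hx with ⟨n, hn, rfl⟩ | rfl
    · rw [adj_virGen, vacuum_raise c h (by omega), map_zero]
    · rw [adj_sub, adj_virGen, adj_algebraMap, hh, sub_mul, map_sub, neg_zero, vacuum_zero_mul,
        ← Algebra.smul_def, map_smul, smul_eq_mul, sub_self, map_zero]
  | zero => simp
  | add x y _ _ hx hy => intro a; rw [mul_add, map_add, hx, hy, add_zero]
  | smul b x _ hx => intro a; rw [smul_eq_mul, ← mul_assoc]; exact hx _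

/-- The source of Hermitian symmetry. The functional and its conjugate both descend to the Verma
module, agree on the generator and vanish on images of raising operators. -/
lemma vacuum_adj (hh : starRingEnd ℂ h = h) (x : VirasoroAlg c) :
    vacuum c h (adj hc x) = starRingEnd ℂ (vacuum c h x) := by
  obtain ⟨g, hg⟩ := exists_functional (exists_smul_vermaVec c h) (conjVacuum hc h - vacuum c h)
    fun x hx ↦ by
      have hx' := (smul_vermaVec_eq_zero c h).1 hx
      rw [LinearMap.sub_apply, conjVacuum_vermaIdeal hc hh hx', vacuum_vermaIdeal c h hx', sub_zero]
  have h0 : g (x • vermaVec c h) = 0 := by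
    refine map_eq_zero_of_mem_iSup_level (c := c) (v := vermaVec c h) ?_ (fun n hn y ↦ ?_)
      (by rw [iSup_level_vermaVec]; trivial)
    · rw [← one_smul (VirasoroAlg c) (vermaVec c h), hg, LinearMap.sub_apply, conjVacuum_apply,
        adj_one, vacuum_one, map_one, sub_self]
    · obtain ⟨u, rfl⟩ := exists_smul_vermaVec c h y
      have hI : virGen c (-n) ∈ vermaIdeal c h :=
        Submodule.subset_span (.inl ⟨-n, by omega, rfl⟩)
      have hI' := vacuum_vermaIdeal c h (Submodule.smul_mem _ (adj hc u) hI)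
      rw [smul_eq_mul] at hI'
      rw [smul_smul, hg, LinearMap.sub_apply, conjVacuum_apply, vacuum_raise c h hn, adj_mul,
        adj_virGen, hI', map_zero, sub_self]
  rw [hg, LinearMap.sub_apply, conjVacuum_apply, sub_eq_zero] at h0
  rw [← h0, Complex.conj_conj]

lemma irrVacuum_adj_smul (hh : starRingEnd ℂ h = h) (x y : VirasoroAlg c) :
    irrVacuum c h (adj hc x • y • irrVec c h) =
      starRingEnd ℂ (irrVacuum c h (adj hc y • x • irrVec c h)) := by
  rw [smul_smul, smul_smul, irrVacuum_smul, irrVacuum_smul, ← vacuum_adj hc hh, adj_mul, adj_adj]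

/-- Makes the form independent of the representative chosen for its first argument. -/
lemma irrVacuum_adj_congr (hh : starRingEnd ℂ h = h) {x x' : VirasoroAlg c}
    (hx : x • irrVec c h = x' • irrVec c h) (y : Irr c h) :
    irrVacuum c h (adj hc x • y) = irrVacuum c h (adj hc x' • y) := by
  obtain ⟨y, rfl⟩ := exists_smul_irrVec c h y
  rw [irrVacuum_adj_smul hc hh, hx, ← irrVacuum_adj_smul hc hh]

/-- The vacuum functional defines a sesquilinear form with the expected adjoints. -/
lemma exists_form (hh : starRingEnd ℂ h = h) : ∃ B : Irr c h →ₗ⋆[ℂ] Irr c h →ₗ[ℂ] ℂ,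
    ∀ (x : VirasoroAlg c) (y : Irr c h), B (x • irrVec c h) y = irrVacuum c h (adj hc x • y) := by
  choose s hs using exists_smul_irrVec c h
  refine ⟨LinearMap.mk₂'ₛₗ (starRingEnd ℂ) (RingHom.id ℂ)
    (fun x y ↦ irrVacuum c h (adj hc (s x) • y)) ?_ ?_ ?_ ?_, fun x y ↦ ?_⟩
  · intro x x' y
    rw [← map_add, ← add_smul, ← adj_add]
    exact irrVacuum_adj_congr hc hh (by rw [add_smul, hs, hs, hs]) y
  · intro a x y
    rw [← map_smul, ← smul_assoc, ← adj_smul]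
    exact irrVacuum_adj_congr hc hh (by rw [smul_assoc, hs, hs]) y
  · intro x y y'
    rw [smul_add, map_add]
  · intro a x y
    have : adj hc (s x) • a • y = a • adj hc (s x) • y :=
      (Algebra.lsmul ℂ ℂ (Irr c h) (adj hc (s x))).map_smul a y
    rw [this, map_smul, RingHom.id_apply]
  · exact irrVacuum_adj_congr hc hh (hs _) y

end Star

/-! ### Quasi-primary fields in the module of the `(2,5)` minimal model -/

lemma L_apply (n : ℤ) (y : W) : L n y = virGen (-22 / 5) n • y := rfl

lemma w_eq : w = irrVec (-22 / 5) (-1 / 5) := rfl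

lemma conj_c : starRingEnd ℂ (-22 / 5) = (-22 / 5) := by
  simp [Complex.conj_ofNat]

lemma conj_h : starRingEnd ℂ (-1 / 5) = (-1 / 5) := by
  simp [Complex.conj_ofNat]

lemma L_L (n m : ℤ) (y : W) :
    L n (L m y) = L m (L n y) + ((m : ℂ) - n) • L (m + n) y + centralTerm (-22 / 5) n m • y :=
  virGen_smul_virGen_smul n m y

/-- The subspace of `W` of level `k`. -/
abbrev lev (k : ℤ) : Submodule ℂ W := level (-22 / 5) w k

lemma isLowestWeight_w : IsLowestWeight (-22 / 5) (-1 / 5) w := isLowestWeight_irrVec _ _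

lemma iSup_lev : ⨆ k, lev k = ⊤ := iSup_level_irrVec _ _

lemma L_mem_lev (m : ℤ) {k : ℤ} {y : W} (hy : y ∈ lev k) : L m y ∈ lev (m + k) :=
  virGen_mem_level isLowestWeight_w m hy

lemma L_zero_of_mem_lev {k : ℤ} {y : W} (hy : y ∈ lev k) : L 0 y = (-1 / 5 + k : ℂ) • y :=
  virGen_zero_smul_of_mem_level isLowestWeight_w hy

lemma eq_zero_of_L {k : ℤ} (hk : k ≠ 0) {y : W} (hy : y ∈ lev k) (h1 : L (-1) y = 0)
    (h2 : L (-2) y = 0) : y = 0 :=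
  eq_zero_of_lower _ _ hk hy h1 h2

/-- Every subspace containing `w` and stable under the generators is everything. -/
lemma eq_top_of_L_mem {S : Submodule ℂ W} (hw : w ∈ S) (hS : ∀ n, ∀ y ∈ S, L n y ∈ S) : S = ⊤ := by
  rw [eq_top_iff, ← iSup_lev]
  refine iSup_le fun k ↦ Submodule.span_le.2 ?_
  rintro _ ⟨l, -, -, rfl⟩
  induction l with
  | nil => exact hw
  | cons a l ih => exact hS a _ ih

lemma eq_zero_of_map_L {f : W →ₗ[ℂ] ℂ} (h0 : f w = 0)
    (hf : ∀ n : ℤ, 0 < n → ∀ y, f (L n y) = 0) : f = 0 :=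
  LinearMap.ext fun y ↦ map_eq_zero_of_mem_iSup_level (c := -22 / 5) h0 hf
    (by rw [iSup_lev]; trivial : y ∈ ⨆ k, lev k)

lemma L_w_of_neg {n : ℤ} (hn : n < 0) : L n w = 0 := isLowestWeight_w.lower n hn

/-- The vacuum functional on `W`. -/
abbrev vacW : W →ₗ[ℂ] ℂ := irrVacuum (-22 / 5) (-1 / 5)

/-- Adjointness moves a raising operator onto `w` as a lowering one, so `B w` kills its image. -/
lemma IsShapovalov.apply_w {B : W →ₗ⋆[ℂ] W →ₗ[ℂ] ℂ} (hB : IsShapovalov B) (y : W) :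
    B w y = B w w * vacW y := by
  have : B w - B w w • vacW = 0 := by
    refine eq_zero_of_map_L ?_ fun n hn y ↦ ?_
    · rw [LinearMap.sub_apply, LinearMap.smul_apply, w_eq, irrVacuum_irrVec, smul_eq_mul, mul_one,
        sub_self]
    · rw [LinearMap.sub_apply, LinearMap.smul_apply, L_apply, irrVacuum_raise _ _ hn, ← L_apply,
        smul_zero, sub_zero]
      have := hB.adjoint (-n) w y
      rw [neg_neg] at this
      rw [← this, L_w_of_neg (by omega), map_zero, LinearMap.zero_apply]
  have := LinearMap.congr_fun this y
  rwa [LinearMap.sub_apply, LinearMap.smul_apply, smul_eq_mul, LinearMap.zero_apply,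
    sub_eq_zero] at this

lemma existsUnique_shapovalov : ∃! B : W →ₗ⋆[ℂ] W →ₗ[ℂ] ℂ, IsShapovalov B ∧ B w w = 1 := by
  obtain ⟨B, hB⟩ := exists_form conj_c conj_h
  refine ⟨B, ⟨⟨fun x y ↦ ?_, fun n x y ↦ ?_⟩, ?_⟩, ?_⟩
  · obtain ⟨x, rfl⟩ := exists_smul_irrVec _ _ x
    obtain ⟨y, rfl⟩ := exists_smul_irrVec _ _ y
    rw [hB, hB, irrVacuum_adj_smul conj_c conj_h]
  · obtain ⟨x, rfl⟩ := exists_smul_irrVec _ _ x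
    rw [L_apply, smul_smul, hB, hB, adj_mul, adj_virGen, mul_smul, L_apply]
  · have := hB 1 w
    rwa [one_smul, adj_one, one_smul, w_eq, irrVacuum_irrVec] at this
  · rintro B' ⟨hB', h1⟩
    have hw : B w = B' w := by
      refine LinearMap.ext fun y ↦ ?_
      have := hB 1 y
      rw [one_smul, adj_one, one_smul, ← w_eq] at this
      rw [this, hB'.apply_w, h1, one_mul]
    have hadj (n : ℤ) (x y : W) : B (L n x) y = B x (L (-n) y) := by
      obtain ⟨x, rfl⟩ := exists_smul_irrVec _ _ x
      rw [L_apply, smul_smul, hB, hB, adj_mul, adj_virGen, mul_smul, L_apply]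
    have htop : LinearMap.ker (B' - B) = ⊤ := by
      refine eq_top_of_L_mem ?_ fun n y hy ↦ ?_
      · rw [LinearMap.mem_ker, LinearMap.sub_apply, hw, sub_self]
      · rw [LinearMap.mem_ker, LinearMap.sub_apply, sub_eq_zero] at hy ⊢
        refine LinearMap.ext fun z ↦ ?_
        rw [hB'.adjoint, hadj, hy]
    exact sub_eq_zero.1 (LinearMap.ker_eq_top.1 htop)

/-- The radical is stable under the algebra, and on it the vacuum functional vanishes. -/
lemma IsShapovalov.nondegenerate {B : W →ₗ⋆[ℂ] W →ₗ[ℂ] ℂ} (hB : IsShapovalov B) (h0 : B w w ≠ 0)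
    {z : W} (hz : ∀ y, B y z = 0) : z = 0 := by
  refine eq_zero_of_irrVacuum_smul _ _ fun u ↦ ?_
  suffices h : ∀ z : W, (∀ y, B y z = 0) → ∀ y, B y (u • z) = 0 by
    have := h z hz w
    rw [hB.apply_w] at this
    exact (mul_eq_zero.1 this).resolve_left h0
  induction u using virasoroAlg_induction with
  | scalar a =>
    intro z hz y
    rw [algebraMap_smul (VirasoroAlg (-22 / 5)) a z, map_smul, hz, smul_zero]
  | gen n =>
    intro z hz y
    have := hB.adjoint (-n) y z
    rw [neg_neg] at this
    rw [← L_apply, ← this, hz]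
  | mul x x' hx hx' =>
    intro z hz
    rw [mul_smul]
    exact hx _ (hx' z hz)
  | add x x' hx hx' =>
    intro z hz y
    rw [add_smul, map_add, hx z hz, hx' z hz, add_zero]

lemma mem_quasiPrimary_iff_forall {B : W →ₗ⋆[ℂ] W →ₗ[ℂ] ℂ} (hB : IsShapovalov B)
    (h0 : B w w ≠ 0) (ψ : W) : ψ ∈ quasiPrimary ↔ ∀ χ ∈ derivativeFields, B χ ψ = 0 := by
  constructor
  · rintro hψ _ ⟨χ, rfl⟩
    rw [hB.adjoint, LinearMap.mem_ker.1 hψ, map_zero]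
  · intro hψ
    refine hB.nondegenerate h0 fun y ↦ ?_
    rw [← hB.adjoint]
    exact hψ _ ⟨y, rfl⟩

/-! ### Levels and weights -/

lemma lev_le_eigenspace (k : ℤ) : lev k ≤ Module.End.eigenspace (L 0) (-1 / 5 + k : ℂ) :=
  fun _ hy ↦ Module.End.mem_eigenspace_iff.2 (L_zero_of_mem_lev hy)

/-- The levels span `W` and lie in eigenspaces for distinct eigenvalues, which are independent. -/
lemma eigenspace_eq_lev (k : ℤ) : Module.End.eigenspace (L 0) (-1 / 5 + k : ℂ) = lev k := by
  refine le_antisymm (fun y hy ↦ ?_) (lev_le_eigenspace k)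
  have htop : y ∈ lev k ⊔ ⨆ j, ⨆ _ : j ≠ k, lev j := by
    rw [← iSup_split_single, iSup_lev]
    trivial
  obtain ⟨a, ha, b, hb, rfl⟩ := Submodule.mem_sup.1 htop
  have hb1 : b ∈ Module.End.eigenspace (L 0) (-1 / 5 + k : ℂ) := by
    simpa using sub_mem hy (lev_le_eigenspace k ha)
  have hb2 : b ∈ ⨆ μ, ⨆ _ : μ ≠ (-1 / 5 + k : ℂ), Module.End.eigenspace (L 0) μ := by
    refine (iSup₂_le fun j hj ↦ ?_ : (⨆ j, ⨆ _ : j ≠ k, lev j) ≤ _) hb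
    exact le_iSup₂_of_le (-1 / 5 + j : ℂ) (by simpa using hj) (lev_le_eigenspace j)
  have := Submodule.disjoint_def.1 ((L 0).eigenspaces_iSupIndep (-1 / 5 + k : ℂ)) b hb1 hb2
  simpa [this] using ha

lemma eigenspace_eq_bot {δ : ℂ} (hδ : ∀ k : ℤ, δ ≠ -1 / 5 + k) :
    Module.End.eigenspace (L 0) δ = ⊥ := by
  have hle : (⊤ : Submodule ℂ W) ≤ ⨆ μ, ⨆ _ : μ ≠ δ, Module.End.eigenspace (L 0) μ := by
    rw [← iSup_lev]
    exact iSup_le fun k ↦ le_iSup₂_of_le (-1 / 5 + k : ℂ) (hδ k).symm (lev_le_eigenspace k)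
  exact ((L 0).eigenspaces_iSupIndep δ).eq_bot_of_le (le_top.trans hle)

/-! ### Integral combinations of products of raising operators -/

/-- Integral linear combinations of products of raising operators. -/
abbrev Comb : Type := List (ℤ × List ℕ)

namespace Comb

/-- Add a term to a combination, merging equal products. -/
def insert (q : ℤ) (l : List ℕ) : Comb → Comb
  | [] => if q = 0 then [] else [(q, l)]
  | (q', l') :: v => if l = l' then
      if q + q' = 0 then v else (q + q', l) :: v
    else (q', l') :: insert q l v

/-- Add `q` times a combination to another one, merging equal products. -/
def addMul (q : ℤ) (v v' : Comb) : Comb :=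
  v.foldr (fun t acc ↦ insert (q * t.1) t.2 acc) v'

/-- Apply `L_a` to a combination. -/
def raise (a : ℕ) (v : Comb) : Comb :=
  v.map fun t ↦ (t.1, a :: t.2)

/-- The product of raising operators transformed by `5 L_{-1}`. -/
def lowerOneWord : List ℕ → Comb
  | [] => []
  | a :: l => addMul 1 (raise a (lowerOneWord l)) <|
      -- The factor 5 clears the denominator of the weight: `[L_{-1}, L_1] = 2 L_0`, and `L_0` acts
      -- by `-1/5 + l.sum`.
      if a = 1 then [(2 * (5 * (l.sum : ℤ) - 1), l)] else [(5 * (a + 1), (a - 1) :: l)]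

/-- The product of raising operators transformed by `5 L_{-2}`. -/
def lowerTwoWord : List ℕ → Comb
  | [] => []
  | a :: l => addMul 1 (raise a (lowerTwoWord l)) <|
      if a = 1 then addMul 3 (lowerOneWord l) []
      -- Here `[L_{-2}, L_2] = 4 L_0 + c / 2` with `c / 2 = -11/5`; five times its value is `20 *
      -- l.sum - 4 - 11`.
      else if a = 2 then [(20 * (l.sum : ℤ) - 15, l)] else [(5 * (a + 2), (a - 2) :: l)]

/-- The combination transformed by `5 L_{-1}`. -/
def lowerOne (v : Comb) : Comb := v.foldr (fun t ↦ addMul t.1 (lowerOneWord t.2)) []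

/-- The combination transformed by `5 L_{-2}`. -/
def lowerTwo (v : Comb) : Comb := v.foldr (fun t ↦ addMul t.1 (lowerTwoWord t.2)) []

/-- Whether all operators that occur in a combination are raising operators. -/
def isRaising (v : Comb) : Bool := v.all fun t ↦ t.2.all (0 < ·)

/-- Whether a combination of level `n` is annihilated by all products of `L_{-1}` and `L_{-2}`
of total level `-n`. -/
def isNull : ℕ → Comb → Bool
  -- Since `insert` merges equal words and drops zero coefficients, cancellation at level 0 leaves
  -- the empty list.
  | 0, v => v.isEmpty
  | 1, v => isRaising v && isNull 0 (lowerOne v)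
  | n + 2, v => v.isEmpty ||
      (isRaising v && (isNull (n + 1) (lowerOne v) && isNull n (lowerTwo v)))

/-- The vector of `W` given by a combination. -/
def eval (v : Comb) : W := (v.map fun t ↦ (t.1 : ℂ) • word (-22 / 5) w t.2).sum

@[simp]
lemma eval_nil : eval [] = 0 := rfl

@[simp]
lemma eval_cons (t : ℤ × List ℕ) (v : Comb) :
    eval (t :: v) = (t.1 : ℂ) • word (-22 / 5) w t.2 + eval v := by
  simp [eval]

lemma eval_insert (q : ℤ) (l : List ℕ) (v : Comb) :
    eval (insert q l v) = (q : ℂ) • word (-22 / 5) w l + eval v := by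
  induction v with
  | nil =>
    rw [insert]
    split_ifs with h
    · simp [h]
    · rfl
  | cons t v ih =>
    rw [insert]
    split_ifs with h1 h2
    · have : (q : ℂ) = -t.1 := by
        rw [eq_neg_iff_add_eq_zero]
        exact_mod_cast h2
      rw [eval_cons, ← h1, this]
      module
    · rw [eval_cons, eval_cons, ← h1]
      push_cast
      module
    · rw [eval_cons, eval_cons, ih]
      module

lemma eval_addMul (q : ℤ) (v v' : Comb) : eval (addMul q v v') = (q : ℂ) • eval v + eval v' := by
  induction v with
  | nil => simp [addMul]
  | cons t v ih =>
    rw [addMul, List.foldr_cons, ← addMul, eval_insert, ih, eval_cons]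
    push_cast
    module

lemma eval_raise (a : ℕ) (v : Comb) : eval (raise a v) = L a (eval v) := by
  induction v with
  | nil => simp [raise]
  | cons t v ih =>
    rw [raise, List.map_cons, ← raise, eval_cons, ih, eval_cons, map_add, map_smul]
    rfl

lemma L_zero_word {l : List ℕ} (hl : ∀ a ∈ l, 0 < a) :
    L 0 (word (-22 / 5) w l) = (-1 / 5 + l.sum : ℂ) • word (-22 / 5) w l := by
  have := L_zero_of_mem_lev (word_mem_level (c := -22 / 5) w hl)
  rwa [Int.cast_natCast] at this

lemma eval_lowerOneWord {l : List ℕ} (hl : ∀ a ∈ l, 0 < a) :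
    eval (lowerOneWord l) = (5 : ℂ) • L (-1) (word (-22 / 5) w l) := by
  induction l with
  | nil => simp [lowerOneWord, L_w_of_neg]
  | cons a l ih =>
    have hl' : ∀ b ∈ l, 0 < b := fun b hb ↦ hl b (by simp [hb])
    have ha : 0 < a := hl a (by simp)
    rw [word_cons, ← L_apply, L_L, lowerOneWord, eval_addMul, eval_raise, ih hl', map_smul]
    split_ifs with h
    · subst h
      simp only [Nat.cast_one, add_neg_cancel, L_zero_word hl', eval_cons, eval_nil, centralTerm]
      generalize l.sum = s
      push_cast
      module
    · rw [centralTerm, if_neg (by omega), eval_cons, eval_nil, word_cons, ← L_apply,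
        Nat.cast_sub ha, sub_eq_add_neg]
      push_cast
      module

lemma eval_lowerTwoWord {l : List ℕ} (hl : ∀ a ∈ l, 0 < a) :
    eval (lowerTwoWord l) = (5 : ℂ) • L (-2) (word (-22 / 5) w l) := by
  induction l with
  | nil => simp [lowerTwoWord, L_w_of_neg]
  | cons a l ih =>
    have hl' : ∀ b ∈ l, 0 < b := fun b hb ↦ hl b (by simp [hb])
    have ha : 0 < a := hl a (by simp)
    rw [word_cons, ← L_apply, L_L, lowerTwoWord, eval_addMul, eval_raise, ih hl', map_smul]
    split_ifs with h1 h2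
    · subst h1
      rw [centralTerm, if_neg (by omega), eval_addMul, eval_lowerOneWord hl', eval_nil,
        show ((1 : ℕ) : ℤ) + -2 = -1 by norm_num]
      push_cast
      module
    · subst h2
      simp only [Nat.cast_ofNat, add_neg_cancel, L_zero_word hl', eval_cons, eval_nil, centralTerm,
        if_true]
      generalize l.sum = s
      push_cast
      module
    · rw [centralTerm, if_neg (by omega), eval_cons, eval_nil, word_cons, ← L_apply,
        Nat.cast_sub (by omega), sub_eq_add_neg]
      push_cast
      module

lemma isRaising_cons {t : ℤ × List ℕ} {v : Comb} (h : isRaising (t :: v)) :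
    (∀ a ∈ t.2, 0 < a) ∧ isRaising v := by
  simpa [isRaising] using h

lemma eval_lowerOne {v : Comb} (hv : isRaising v) :
    eval (lowerOne v) = (5 : ℂ) • L (-1) (eval v) := by
  induction v with
  | nil => simp [lowerOne]
  | cons t v ih =>
    obtain ⟨h1, h2⟩ := isRaising_cons hv
    rw [lowerOne, List.foldr_cons, ← lowerOne, eval_addMul, eval_lowerOneWord h1, ih h2,
      eval_cons, map_add, map_smul]
    module

lemma eval_lowerTwo {v : Comb} (hv : isRaising v) :
    eval (lowerTwo v) = (5 : ℂ) • L (-2) (eval v) := by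
  induction v with
  | nil => simp [lowerTwo]
  | cons t v ih =>
    obtain ⟨h1, h2⟩ := isRaising_cons hv
    rw [lowerTwo, List.foldr_cons, ← lowerTwo, eval_addMul, eval_lowerTwoWord h1, ih h2,
      eval_cons, map_add, map_smul]
    module

/-- Whether a combination is a combination of products of raising operators of level `n`. -/
def isLevel (n : ℕ) (v : Comb) : Bool := v.all fun t ↦ t.2.all (0 < ·) && t.2.sum == n

lemma eval_mem_lev {n : ℕ} {v : Comb} (hv : isLevel n v) : eval v ∈ lev n := by
  induction v with
  | nil => exact zero_mem _
  | cons t v ih =>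
    obtain ⟨⟨h1, h2⟩, h3⟩ : ((∀ a ∈ t.2, 0 < a) ∧ t.2.sum = n) ∧ isLevel n v := by
      simpa [isLevel] using hv
    rw [eval_cons, ← h2]
    exact add_mem (Submodule.smul_mem _ _ (word_mem_level _ h1)) (h2 ▸ ih h3)

lemma eval_eq_zero_of_isEmpty {v : Comb} (hv : v.isEmpty) : eval v = 0 := by
  rw [List.isEmpty_iff.1 hv, eval_nil]

/-- Irreducibility drives the descent: a vector of positive level is zero once its images under
`L_{-1}` and `L_{-2}`, which have lower level, are zero. -/
lemma eval_eq_zero_of_isNull_of_mem (n : ℕ) {v : Comb} (hv : isNull n v) (hn : eval v ∈ lev n) :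
    eval v = 0 := by
  induction n using Nat.strong_induction_on generalizing v with
  | _ n ih =>
    have h5 : (5 : ℂ) ≠ 0 := by norm_num
    match n, hv with
    | 0, hv => exact eval_eq_zero_of_isEmpty hv
    | 1, hv =>
      obtain ⟨h1, h2⟩ : isRaising v ∧ isNull 0 (lowerOne v) := by simpa [isNull] using hv
      have e := eval_lowerOne h1
      rw [eval_eq_zero_of_isEmpty h2] at e
      refine eq_zero_of_L one_ne_zero hn ((smul_eq_zero.1 e.symm).resolve_left h5) ?_
      have := L_mem_lev (-2) hn
      rwa [lev, level_of_neg w (by norm_num), Submodule.mem_bot] at this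
    | n + 2, hv =>
      rcases Bool.or_eq_true_iff.1 hv with hv | hv
      · exact eval_eq_zero_of_isEmpty hv
      simp only [Bool.and_eq_true] at hv
      obtain ⟨h0, h1, h2⟩ := hv
      have e1 := eval_lowerOne h0
      have e2 := eval_lowerTwo h0
      rw [ih (n + 1) (by omega) h1] at e1
      · rw [ih n (by omega) h2] at e2
        · exact eq_zero_of_L (by omega) hn ((smul_eq_zero.1 e1.symm).resolve_left h5)
            ((smul_eq_zero.1 e2.symm).resolve_left h5)
        · rw [e2]
          have := L_mem_lev (-2) hn
          rw [show (-2 : ℤ) + (n + 2 : ℕ) = n by push_cast; ring] at this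
          exact Submodule.smul_mem _ _ this
      · rw [e1]
        have := L_mem_lev (-1) hn
        rw [show (-1 : ℤ) + (n + 2 : ℕ) = (n + 1 : ℕ) by push_cast; ring] at this
        exact Submodule.smul_mem _ _ this

/-- Relations between products of raising operators are decided by computation. -/
lemma eval_eq_zero (n : ℕ) {v : Comb} (hv : (isLevel n v && isNull n v) = true) : eval v = 0 := by
  rw [Bool.and_eq_true] at hv
  exact eval_eq_zero_of_isNull_of_mem n hv.2 (eval_mem_lev hv.1)

end Comb

/-! ### Levels modulo derivative fields -/

/-- If `lev j` is spanned by derivatives and a vector `v j` for `j < n`, and each `L_{n-j} (v j)` is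
a derivative up to a multiple of `v n`, then `lev n` is spanned by derivatives and `v n`. -/
lemma lev_le_of_forall {v : ℕ → W} {n : ℕ} (hn : 0 < n) (h0 : v 0 = w)
    (hlt : ∀ j, 0 < j → j < n → lev j ≤ (lev (j - 1)).map (L 1) ⊔ Submodule.span ℂ {v j})
    (hv : ∀ j a, 1 < a → a + j = n →
      L a (v j) ∈ (lev (n - 1)).map (L 1) ⊔ Submodule.span ℂ {v n}) :
    lev n ≤ (lev (n - 1)).map (L 1) ⊔ Submodule.span ℂ {v n} := by
  set S := (lev (n - 1)).map (L 1) ⊔ Submodule.span ℂ {v n} with hS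
  have hder {y : W} (hy : y ∈ lev (n - 1)) : L 1 y ∈ S :=
    Submodule.mem_sup_left (Submodule.mem_map_of_mem hy)
  have key : ∀ j a : ℕ, 0 < a → a + j = n → ∀ y ∈ lev j, L a y ∈ S := by
    intro j
    induction j with
    | zero =>
      intro a ha haj y hy
      rw [lev, Nat.cast_zero, level_zero] at hy
      obtain ⟨r, rfl⟩ := Submodule.mem_span_singleton.1 hy
      rw [map_smul]
      refine Submodule.smul_mem _ _ ?_
      rcases Nat.lt_or_ge 1 a with h | h
      · exact h0 ▸ hv 0 a h haj
      · obtain rfl : a = 1 := by omega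
        refine hder ?_
        rw [show (n : ℤ) - 1 = 0 by omega, lev, level_zero]
        exact Submodule.mem_span_singleton_self w
    | succ j ih =>
      intro a ha haj y hy
      rcases Nat.lt_or_ge 1 a with h | h
      · obtain ⟨_, ⟨z, hz, rfl⟩, b, hb, rfl⟩ := Submodule.mem_sup.1 (hlt (j + 1) (by omega)
          (by omega) hy)
        obtain ⟨r, rfl⟩ := Submodule.mem_span_singleton.1 hb
        rw [Nat.cast_succ, add_sub_cancel_right] at hz
        rw [map_add, map_smul]
        refine add_mem ?_ (Submodule.smul_mem _ _ (hv _ a h haj))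
        -- `L_a L_1 z = L_1 L_a z + (1 - a) L_{a+1} z`: the first term is a derivative, and the
        -- second has `z` one level lower, where the induction applies.
        rw [L_L, centralTerm, if_neg (by omega), zero_smul, add_zero]
        refine add_mem (hder ?_) (Submodule.smul_mem _ _ ?_)
        · have := L_mem_lev a hz
          rwa [show (a : ℤ) + j = n - 1 by omega] at this
        · have := ih (a + 1) (by omega) (by omega) z hz
          rwa [Nat.cast_succ, add_comm] at this
      · obtain rfl : a = 1 := by omega
        refine hder ?_
        rwa [show (n : ℤ) - 1 = (j + 1 : ℕ) by omega]
  refine level_induction (by omega) fun a ha y hy ↦ ?_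
  rcases Nat.lt_or_ge n a with h | h
  · rw [level_of_neg w (by omega), Submodule.mem_bot] at hy
    rw [hy, smul_zero]
    exact zero_mem _
  · refine key (n - a) a ha (by omega) y ?_
    rwa [Nat.cast_sub h]

open Comb

/-- The levels up to `11` for which `L_n w` is not a derivative field. -/
def isExtra (n : ℕ) : Bool := [4, 6, 8, 9, 10, 11].contains n

/-- Non-derivative fields of level at most `11`. -/
def extraField (n : ℕ) : W := if n = 0 then w else if isExtra n then L n w else 0

/-- The word `L_{n-j} L_j`, or `L_n` if `j = 0`. -/
def extraWord (n j : ℕ) : List ℕ := if j = 0 then [n] else [n - j, j]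

/-- The triple `(d, s, u)` means that `d` times the product `extraWord n j` applied to `w` equals
`s L_n w + L_1 u`. -/
def reduction : ℕ → ℕ → ℤ × ℤ × Comb
  -- The null vector of level 2: `2 L_2 w = 5 L_1 L_1 w`.
  | 2, 0 => (2, 0, [(5, [1])])
  | 3, 0 => (6, 0, [(5, [2])])
  | 5, 0 => (114, 0, [(90, [4]), (-25, [1, 3])])
  | 6, 4 => (2, 64, [(-30, [5]), (5, [1, 4])])
  | 7, 0 => (4872, 0, [(1760, [6]), (-225, [1, 5]), (50, [2, 4])])
  | 7, 4 => (2436, 0, [(8620, [6]), (-1275, [1, 5]), (-1070, [2, 4])])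
  | 8, 4 => (15, 5481, [(-1705, [7]), (175, [1, 6]), (-25, [2, 5])])
  | 8, 6 => (2, 158, [(-50, [7]), (5, [1, 6])])
  | 9, 4 => (12, 4098, [(-1112, [8]), (95, [1, 7]), (-10, [2, 6])])
  | 9, 6 => (12, -5214, [(1460, [8]), (-125, [1, 7]), (10, [2, 6])])
  | 10, 4 => (1980, 3298548, [(-799330, [9]), (58950, [1, 8]), (-4750, [2, 7]), (1650, [3,
      6]), (-375, [1, 3, 5])])
  | 10, 6 => (1980, 3302508, [(-799330, [9]), (58950, [1, 8]), (-4750, [2, 7]), (1650, [3,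
      6]), (-375, [1, 3, 5])])
  | 10, 8 => (2, 292, [(-70, [9]), (5, [1, 8])])
  | 11, 4 => (336, 686952, [(-150846, [10]), (9635, [1, 9]), (-530, [2, 8]), (250, [3, 7]),
      (90, [4, 6]), (-25, [1, 3, 6])])
  | 11, 6 => (336, -390264, [(87230, [10]), (-5575, [1, 9]), (250, [2, 8]), (-250, [3, 7]),
      (-90, [4, 6]), (25, [1, 3, 6])])
  | 11, 8 => (12, -12540, [(2740, [10]), (-175, [1, 9]), (10, [2, 8])])
  | 11, 9 => (2, 374, [(-80, [10]), (5, [1, 9])])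
  -- Among the pairs that are tested, this is reached only for `j = 0` with `isExtra n`, where it
  -- reads `L_n w = L_n w`.
  | _, _ => (1, 1, [])

/-- The combination that vanishes according to `reduction`. -/
def reductionComb (n j : ℕ) : Comb :=
  (-(reduction n j).1, extraWord n j) :: ((reduction n j).2.1, [n]) ::
    raise 1 (reduction n j).2.2

/-- The test that `reduction` is correct. -/
def checkReduction (n j : ℕ) : Bool :=
  (reduction n j).1 != 0 && ((reduction n j).2.1 == 0 || isExtra n) &&
    isLevel (n - 1) (reduction n j).2.2 && (isLevel n (reductionComb n j) &&
      isNull n (reductionComb n j))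

/-- The case `j = n - 1` is left out because `L_{n-j} = L_1` then gives a derivative. -/
lemma checkReduction_eq_true : ∀ n < 12, ∀ j < n - 1, j = 0 ∨ isExtra j = true →
    checkReduction n j = true := by
  decide +kernel

lemma extraWord_mem {n j : ℕ} (h : checkReduction n j = true) (hn : 0 < n) :
    word (-22 / 5) w (extraWord n j) ∈
      (lev (n - 1)).map (L 1) ⊔ Submodule.span ℂ {extraField n} := by
  simp only [checkReduction, Bool.and_eq_true, Bool.or_eq_true, bne_iff_ne, beq_iff_eq] at h
  obtain ⟨⟨⟨hd, hs⟩, hu⟩, h⟩ := h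
  have h0 := eval_eq_zero n (Bool.and_eq_true_iff.2 h)
  rw [reductionComb, eval_cons, eval_cons, eval_raise] at h0
  have hmem := eval_mem_lev hu
  rw [Nat.cast_pred hn] at hmem
  have hd' : ((reduction n j).1 : ℂ) ≠ 0 := Int.cast_ne_zero.2 hd
  rw [← Submodule.smul_mem_iff _ hd']
  have e : ((reduction n j).1 : ℂ) • word (-22 / 5) w (extraWord n j) =
      L 1 (eval (reduction n j).2.2) + ((reduction n j).2.1 : ℂ) • L n w := by
    simp only [word_cons, word_nil, ← L_apply, Int.cast_neg, neg_smul, Nat.cast_one] at h0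
    rw [neg_add_eq_zero] at h0
    rw [h0, add_comm]
  rw [e]
  refine add_mem (Submodule.mem_sup_left (Submodule.mem_map_of_mem hmem)) ?_
  rcases hs with hs | hs
  · rw [hs, Int.cast_zero, zero_smul]
    exact zero_mem _
  · refine Submodule.smul_mem _ _ (Submodule.mem_sup_right ?_)
    rw [extraField, if_neg hn.ne', if_pos hs]
    exact Submodule.mem_span_singleton_self _

lemma lev_le (n : ℕ) (hn : 0 < n) (h : n < 12) :
    lev n ≤ (lev (n - 1)).map (L 1) ⊔ Submodule.span ℂ {extraField n} := by
  induction n using Nat.strong_induction_on with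
  | _ n ih =>
    refine lev_le_of_forall hn rfl (fun j h0 hj ↦ ih j hj h0 (by omega)) fun j a ha haj ↦ ?_
    have haj' : n - j = a := by omega
    by_cases hj : j = 0
    · have := extraWord_mem (checkReduction_eq_true n h j (by omega) (.inl hj)) hn
      rw [extraWord, if_pos hj] at this
      rwa [show extraField j = w from if_pos hj, show a = n by omega]
    · rw [show extraField j = if isExtra j then L j w else 0 from if_neg hj]
      split_ifs with hx
      · have := extraWord_mem (checkReduction_eq_true n h j (by omega) (.inr hx)) hn
        rwa [extraWord, if_neg hj, haj'] at this
      · rw [map_zero]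
        exact zero_mem _

/-! ### Quasi-primary fields of given weight -/

lemma quasiPrimaryOfWeight_eq {δ : ℝ} {k : ℤ} (h : δ = -1 / 5 + k) :
    quasiPrimaryOfWeight δ = quasiPrimary ⊓ lev k := by
  rw [quasiPrimaryOfWeight, ← eigenspace_eq_lev, h]
  push_cast
  rfl

lemma quasiPrimaryOfWeight_eq_bot {δ : ℝ} (h : ∀ k : ℕ, δ ≠ -1 / 5 + k) :
    quasiPrimaryOfWeight δ = ⊥ := by
  by_cases hk : ∃ k : ℤ, δ = -1 / 5 + k
  · obtain ⟨k, hk⟩ := hk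
    have hneg : k < 0 := by
      by_contra! h0
      lift k to ℕ using h0
      exact h k hk
    rw [quasiPrimaryOfWeight_eq hk, lev, level_of_neg w hneg, inf_bot_eq]
  · push Not at hk
    rw [quasiPrimaryOfWeight, eigenspace_eq_bot, inf_bot_eq]
    intro k hk'
    refine hk k ?_
    exact_mod_cast hk'

/-- `L_0` is self-adjoint and its eigenvalues on the two levels are real and distinct. -/
lemma IsShapovalov.apply_eq_zero_of_ne {B : W →ₗ⋆[ℂ] W →ₗ[ℂ] ℂ} (hB : IsShapovalov B) {j k : ℤ}
    (hjk : j ≠ k) {x y : W} (hx : x ∈ lev j) (hy : y ∈ lev k) : B x y = 0 := by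
  have h := hB.adjoint 0 x y
  rw [neg_zero, L_zero_of_mem_lev hx, L_zero_of_mem_lev hy, map_smulₛₗ, map_smul,
    LinearMap.smul_apply, map_add, conj_h, map_intCast, ← sub_eq_zero, ← sub_smul,
    add_sub_add_left_eq_sub] at h
  refine (smul_eq_zero.1 h).resolve_left ?_
  rw [← ne_eq, sub_ne_zero]
  exact_mod_cast hjk

/-- A quasi-primary field of level `n` is determined by its pairing with a vector that spans the
level modulo derivatives. -/
lemma IsShapovalov.eq_zero_of_apply_eq_zero {B : W →ₗ⋆[ℂ] W →ₗ[ℂ] ℂ} (hB : IsShapovalov B)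
    (h0 : B w w ≠ 0) {k : ℤ} {S : Submodule ℂ W} {v ψ : W}
    (hv : lev k ≤ S.map (L 1) ⊔ Submodule.span ℂ {v})
    (hψ : ψ ∈ quasiPrimary ⊓ lev k) (h : B v ψ = 0) : ψ = 0 := by
  refine hB.nondegenerate h0 fun y ↦ ?_
  suffices ⊤ ≤ LinearMap.ker (B.flip ψ) by simpa using this (Submodule.mem_top : y ∈ ⊤)
  rw [← iSup_lev]
  refine iSup_le fun j ↦ ?_
  by_cases hj : j = k
  · subst hj
    refine hv.trans (sup_le ?_ ((Submodule.span_singleton_le_iff_mem _ _).2 h))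
    rintro _ ⟨χ, -, rfl⟩
    exact (mem_quasiPrimary_iff_forall hB h0 ψ).1 hψ.1 _ ⟨χ, rfl⟩
  · exact fun y hy ↦ hB.apply_eq_zero_of_ne hj hy hψ.2

/-- Pairing with `v` is an injective functional on these quasi-primary vectors. -/
lemma rank_quasiPrimary_inf_lev_le_one {k : ℤ} {S : Submodule ℂ W} {v : W}
    (hv : lev k ≤ S.map (L 1) ⊔ Submodule.span ℂ {v}) :
    Module.rank ℂ (quasiPrimary ⊓ lev k : Submodule ℂ W) ≤ 1 := by
  obtain ⟨B, ⟨hB, h1⟩, -⟩ := existsUnique_shapovalov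
  have h0 : B w w ≠ 0 := by rw [h1]; exact one_ne_zero
  rw [← Module.rank_self ℂ]
  refine LinearMap.rank_le_of_injective ((B v).domRestrict (quasiPrimary ⊓ lev k : Submodule ℂ W)) ?_
  rw [← LinearMap.ker_eq_bot, LinearMap.ker_eq_bot']
  exact fun ψ hψ ↦ Subtype.ext (hB.eq_zero_of_apply_eq_zero h0 hv ψ.2 hψ)

lemma quasiPrimary_inf_lev_eq_bot {n : ℕ} (hn : 0 < n) (h : n < 12) (hx : isExtra n = false) :
    quasiPrimary ⊓ lev n = ⊥ := by
  obtain ⟨B, ⟨hB, h1⟩, -⟩ := existsUnique_shapovalov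
  have h0 : B w w ≠ 0 := by rw [h1]; exact one_ne_zero
  refine (Submodule.eq_bot_iff _).2 fun ψ hψ ↦
    hB.eq_zero_of_apply_eq_zero h0 (lev_le n hn h) hψ ?_
  rw [extraField, if_neg hn.ne', hx, if_neg Bool.false_ne_true, map_zero, LinearMap.zero_apply]

lemma rank_quasiPrimaryOfWeight_le_one {δ : ℝ} (hδ : δ ≤ 11) :
    Module.rank ℂ (quasiPrimaryOfWeight δ) ≤ 1 := by
  by_cases hk : ∃ n : ℕ, δ = -1 / 5 + n
  · obtain ⟨n, rfl⟩ := hk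
    have hn : n < 12 := by
      -- A weight `-1/5 + n ≤ 11` means `n ≤ 11.2`, so level 11 is the last one to treat.
      have : (n : ℝ) < 12 := by linarith
      exact_mod_cast this
    rw [quasiPrimaryOfWeight_eq (k := n) (by simp)]
    rcases Nat.eq_zero_or_pos n with rfl | h0
    · refine rank_quasiPrimary_inf_lev_le_one (S := ⊥) (v := w) ?_
      rw [Nat.cast_zero, lev, level_zero]
      exact le_sup_right
    · exact rank_quasiPrimary_inf_lev_le_one (lev_le n h0 hn)
  · push Not at hk
    rw [quasiPrimaryOfWeight_eq_bot hk, rank_bot]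
    exact zero_le_one

lemma quasiPrimaryOfWeight_eq_bot_of_lt {δ : ℝ} (hδ : δ < 6) (h0 : δ ≠ -1 / 5)
    (h4 : δ ≠ -1 / 5 + 4) (h6 : δ ≠ -1 / 5 + 6) : quasiPrimaryOfWeight δ = ⊥ := by
  by_cases hk : ∃ n : ℕ, δ = -1 / 5 + n
  · obtain ⟨n, rfl⟩ := hk
    have hn : n < 7 := by
      have : (n : ℝ) < 7 := by linarith
      exact_mod_cast this
    rw [quasiPrimaryOfWeight_eq (k := n) (by simp)]
    have hx : 0 < n ∧ isExtra n = false := by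
      interval_cases n <;> simp_all [isExtra]
    exact quasiPrimary_inf_lev_eq_bot hx.1 (by omega) hx.2
  · push Not at hk
    exact quasiPrimaryOfWeight_eq_bot hk

lemma eq_span_singleton_of_rank_le_one {S : Submodule ℂ W} (h : Module.rank ℂ S ≤ 1) {v : W}
    (hv : v ∈ S) (h0 : v ≠ 0) : S = Submodule.span ℂ {v} := by
  obtain ⟨u, -, hu⟩ := (rank_submodule_le_one_iff S).1 h
  refine le_antisymm (hu.trans ?_) ((Submodule.span_singleton_le_iff_mem _ _).2 hv)
  obtain ⟨r, rfl⟩ := Submodule.mem_span_singleton.1 (hu hv)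
  have hr : r ≠ 0 := fun hr ↦ h0 (by rw [hr, zero_smul])
  rw [Submodule.span_singleton_smul_eq (IsUnit.mk0 r hr)]

/-! ### The explicit quasi-primary fields -/

/-- The combination for `psi4`. -/
def comb4 : Comb := [(52, [4]), (-25, [1, 3])]

/-- The combination for `35 psi6`. -/
def comb6 : Comb := [(140, [1, 5]), (105, [3, 3]), (-684, [6])]

lemma eval_comb4 : eval comb4 = psi4 := by
  simp only [comb4, eval_cons, eval_nil, word_cons, word_nil, ← L_apply, psi4]
  push_cast
  module

lemma eval_comb6 : eval comb6 = (35 : ℂ) • psi6 := by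
  simp only [comb6, eval_cons, eval_nil, word_cons, word_nil, ← L_apply, psi6]
  push_cast
  module

lemma eval_mem_quasiPrimary (n : ℕ) {v : Comb} (hv : (isRaising v &&
    (isLevel n (lowerOne v) && isNull n (lowerOne v))) = true) : eval v ∈ quasiPrimary := by
  rw [Bool.and_eq_true] at hv
  have := eval_lowerOne hv.1
  rw [eval_eq_zero n hv.2] at this
  exact (smul_eq_zero.1 this.symm).resolve_left (by norm_num)

lemma psi4_mem : psi4 ∈ quasiPrimaryOfWeight (-1 / 5 + 4) := by
  rw [quasiPrimaryOfWeight_eq (k := (4 : ℕ)) (by norm_num), ← eval_comb4]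
  exact ⟨eval_mem_quasiPrimary 3 (by decide +kernel), eval_mem_lev (by decide +kernel)⟩

lemma psi6_mem : psi6 ∈ quasiPrimaryOfWeight (-1 / 5 + 6) := by
  rw [quasiPrimaryOfWeight_eq (k := (6 : ℕ)) (by norm_num),
    ← Submodule.smul_mem_iff _ (by norm_num : (35 : ℂ) ≠ 0), ← eval_comb6]
  exact ⟨eval_mem_quasiPrimary 5 (by decide +kernel), eval_mem_lev (by decide +kernel)⟩

lemma w_ne_zero : w ≠ 0 := fun h ↦ by
  have := irrVacuum_irrVec (-22 / 5) (-1 / 5)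
  rw [← w_eq, h, map_zero] at this
  exact zero_ne_one this

lemma w_mem : w ∈ quasiPrimaryOfWeight (-1 / 5) := by
  rw [quasiPrimaryOfWeight_eq (k := 0) (by norm_num), lev, level_zero]
  exact ⟨L_w_of_neg (by norm_num), Submodule.mem_span_singleton_self w⟩

/-! ### Norms -/

lemma L_neg_L_w {n m : ℤ} (hn : n < 0) (hmn : m + n ≠ 0) :
    L n (L m w) = ((m : ℂ) - n) • L (m + n) w := by
  rw [L_L, L_w_of_neg hn, map_zero, zero_add, centralTerm, if_neg hmn, zero_smul, add_zero]

lemma L_neg_L_self_w {m : ℤ} (hm : 0 < m) : L (-m) (L m w) =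
    (-2 * m / 5 - 11 / 30 * m * ((m : ℂ) ^ 2 - 1) : ℂ) • w := by
  have h0 : L 0 w = (-1 / 5 : ℂ) • w := isLowestWeight_w.weight
  rw [L_L, L_w_of_neg (by omega), map_zero, zero_add, centralTerm, if_pos (by omega),
    add_neg_cancel, h0]
  push_cast
  module

lemma norm_psi4 {B : W →ₗ⋆[ℂ] W →ₗ[ℂ] ℂ} (hB : IsShapovalov B) :
    B psi4 psi4 = 5928 / 5 * B w w := by
  have hqp : L (-1) psi4 = 0 := psi4_mem.1
  have h4 : L (-4) psi4 = (114 / 5 : ℂ) • w := by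
    have e1 : L (-4) (L 4 w) = _ := L_neg_L_self_w (m := 4) (by norm_num)
    have e2 : L (-4) (L 1 (L 3 w)) = (-50 : ℂ) • w := by
      have e3 : L (-3) (L 3 w) = _ := L_neg_L_self_w (m := 3) (by norm_num)
      rw [L_L, L_neg_L_w (by norm_num) (by norm_num), show (3 : ℤ) + -4 = -1 by norm_num,
        L_w_of_neg (by norm_num), show (1 : ℤ) + -4 = -3 by norm_num, e3, centralTerm,
        if_neg (by norm_num)]
      push_cast
      simp only [smul_zero, map_zero]
      module
    rw [psi4, map_sub, map_smul, map_smul, e1, e2]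
    push_cast
    module
  have e (z : W) : B psi4 z = 52 * B (L 4 w) z - 25 * B (L 1 (L 3 w)) z := by
    simp [psi4, Complex.conj_ofNat]
  -- The word starting with `L_1` is orthogonal to the quasi-primary `psi4`; what remains is `52 *
  -- (114 / 5)`.
  rw [e, hB.adjoint 4, hB.adjoint 1, hqp, h4, map_zero, map_smul, smul_eq_mul]
  ring

lemma norm_psi6 {B : W →ₗ⋆[ℂ] W →ₗ[ℂ] ℂ} (hB : IsShapovalov B) :
    B psi6 psi6 = 6539268 / 6125 * B w w := by
  have hqp : L (-1) psi6 = 0 := psi6_mem.1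
  have h33 : L (-3) (L 3 w) = (-10 : ℂ) • w := by
    have := L_neg_L_self_w (m := 3) (by norm_num)
    rw [this]
    norm_num
  -- `L_{-6}` takes `L_1 L_5 w`, `L_3 L_3 w` and `L_6 w` to `-322 w`, `-90 w` and `-397/5 w`.
  have h6 : L (-6) psi6 = (-(4 * 322) - 3 * 90 + 684 / 35 * (397 / 5) : ℂ) • w := by
    have e1 : L (-6) (L 6 w) = _ := L_neg_L_self_w (m := 6) (by norm_num)
    have e2 : L (-6) (L 1 (L 5 w)) = (-322 : ℂ) • w := by
      have e3 : L (-5) (L 5 w) = _ := L_neg_L_self_w (m := 5) (by norm_num)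
      rw [L_L, L_neg_L_w (by norm_num) (by norm_num), show (5 : ℤ) + -6 = -1 by norm_num,
        L_w_of_neg (by norm_num), show (1 : ℤ) + -6 = -5 by norm_num, e3, centralTerm,
        if_neg (by norm_num)]
      push_cast
      simp only [smul_zero, map_zero]
      module
    have e4 : L (-6) (L 3 (L 3 w)) = (-90 : ℂ) • w := by
      rw [L_L, L_neg_L_w (by norm_num) (by norm_num), show (3 : ℤ) + -6 = -3 by norm_num,
        L_w_of_neg (by norm_num), h33, centralTerm, if_neg (by norm_num)]
      push_cast
      simp only [smul_zero, map_zero]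
      module
    rw [psi6, map_sub, map_add, map_smul, map_smul, map_smul, e1, e2, e4]
    push_cast
    module
  have h3 : L (-3) (L (-3) psi6) = (2204 / 7 : ℂ) • w := by
    have e1 : L (-3) (L 1 (L 5 w)) = (8 : ℂ) • L 1 (L 2 w) + (28 : ℂ) • L 3 w := by
      rw [L_L, L_neg_L_w (by norm_num) (by norm_num), show (1 : ℤ) + -3 = -2 by norm_num,
        L_neg_L_w (by norm_num) (by norm_num), centralTerm, if_neg (by norm_num), map_smul,
        show (5 : ℤ) + -3 = 2 by norm_num, show (5 : ℤ) + -2 = 3 by norm_num]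
      push_cast
      module
    have e2 : L (-3) (L 3 (L 3 w)) = (-2 : ℂ) • L 3 w := by
      have h0 : L 0 (L 3 w) = _ := L_zero_of_mem_lev (L_mem_lev 3 (k := 0) (y := w) (by
        rw [lev, level_zero]; exact Submodule.mem_span_singleton_self w))
      rw [L_L, h33, add_neg_cancel, h0, centralTerm, if_pos (by norm_num), map_smul]
      push_cast
      module
    have e3 : L (-3) (L 6 w) = (9 : ℂ) • L 3 w := by
      rw [L_neg_L_w (by norm_num) (by norm_num)]
      norm_num
    have e4 : L (-3) (L 1 (L 2 w)) = (-12 : ℂ) • w := by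
      have e5 : L (-2) (L 2 w) = _ := L_neg_L_self_w (m := 2) (by norm_num)
      rw [L_L, L_neg_L_w (by norm_num) (by norm_num), show (2 : ℤ) + -3 = -1 by norm_num,
        L_w_of_neg (by norm_num), show (1 : ℤ) + -3 = -2 by norm_num, e5, centralTerm,
        if_neg (by norm_num)]
      push_cast
      simp only [smul_zero, map_zero]
      module
    simp only [psi6, map_sub, map_add, map_smul, e1, e2, e3, e4, h33]
    module
  have e (z : W) : B psi6 z = 4 * B (L 1 (L 5 w)) z + 3 * B (L 3 (L 3 w)) z -
      684 / 35 * B (L 6 w) z := by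
    simp [psi6, Complex.conj_ofNat]
  -- Again the word starting with `L_1` drops out, leaving only the pairings with `L_3 L_3 w` and
  -- `L_6 w`.
  rw [e, hB.adjoint 1, hB.adjoint 3, hB.adjoint 3, hB.adjoint 6, hqp, h3, h6, map_zero, map_smul,
    map_smul, smul_eq_mul, smul_eq_mul]
  ring

/-- The norm for the normalised form is nonzero. -/
lemma psi4_ne_zero : psi4 ≠ 0 := fun h ↦ by
  obtain ⟨B, ⟨hB, h1⟩, -⟩ := existsUnique_shapovalov
  have := norm_psi4 hB
  rw [h, map_zero, h1] at this
  norm_num at this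

lemma psi6_ne_zero : psi6 ≠ 0 := fun h ↦ by
  obtain ⟨B, ⟨hB, h1⟩, -⟩ := existsUnique_shapovalov
  have := norm_psi6 hB
  rw [h, map_zero, h1] at this
  norm_num at this

end LeeYang

end

theorem mainTheorem11 :
    -- the Shapovalov form exists and is unique up to normalisation; quasi-primary fields are
    -- exactly the fields orthogonal to all derivative fields
    (∃! B : LeeYang.W →ₗ⋆[ℂ] LeeYang.W →ₗ[ℂ] ℂ, IsShapovalov B ∧ B w w = 1) ∧
    (∀ B : LeeYang.W →ₗ⋆[ℂ] LeeYang.W →ₗ[ℂ] ℂ, IsShapovalov B → B w w ≠ 0 →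
      ∀ ψ : LeeYang.W, ψ ∈ quasiPrimary ↔ ∀ χ ∈ derivativeFields, B χ ψ = 0) ∧
    -- at most one quasi-primary field, up to normalisation, for every weight at most 11
    (∀ δ : ℝ, δ ≤ 11 → Module.rank ℂ (quasiPrimaryOfWeight δ) ≤ 1) ∧
    -- the complete list for weights below 6
    (∀ δ : ℝ, δ < 6 → δ ≠ -1 / 5 → δ ≠ -1 / 5 + 4 → δ ≠ -1 / 5 + 6 →
      quasiPrimaryOfWeight δ = ⊥) ∧
    quasiPrimaryOfWeight (-1 / 5 + 2) = ⊥ ∧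
    (w ≠ 0 ∧ quasiPrimaryOfWeight (-1 / 5) = Submodule.span ℂ {w}) ∧
    (psi4 ≠ 0 ∧ quasiPrimaryOfWeight (-1 / 5 + 4) = Submodule.span ℂ {psi4}) ∧
    (psi6 ≠ 0 ∧ quasiPrimaryOfWeight (-1 / 5 + 6) = Submodule.span ℂ {psi6}) ∧
    -- the squared norms
    (∀ B : LeeYang.W →ₗ⋆[ℂ] LeeYang.W →ₗ[ℂ] ℂ, IsShapovalov B →
      B psi4 psi4 = 5928 / 5 * B w w ∧
      B psi6 psi6 = 6539268 / 6125 * B w w) := by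
  refine ⟨existsUnique_shapovalov, fun B hB h0 ψ ↦ mem_quasiPrimary_iff_forall hB h0 ψ,
    fun δ hδ ↦ rank_quasiPrimaryOfWeight_le_one hδ,
    fun δ hδ h0 h4 h6 ↦ quasiPrimaryOfWeight_eq_bot_of_lt hδ h0 h4 h6, ?_,
    ⟨w_ne_zero, ?_⟩, ⟨psi4_ne_zero, ?_⟩, ⟨psi6_ne_zero, ?_⟩,
    fun B hB ↦ ⟨norm_psi4 hB, norm_psi6 hB⟩⟩
  · exact quasiPrimaryOfWeight_eq_bot_of_lt (by norm_num) (by norm_num) (by norm_num) (by norm_num)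
  · exact eq_span_singleton_of_rank_le_one (rank_quasiPrimaryOfWeight_le_one (by norm_num)) w_mem
      w_ne_zero
  · exact eq_span_singleton_of_rank_le_one (rank_quasiPrimaryOfWeight_le_one (by norm_num))
      psi4_mem psi4_ne_zero
  · exact eq_span_singleton_of_rank_le_one (rank_quasiPrimaryOfWeight_le_one (by norm_num))
      psi6_mem psi6_ne_zero
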